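/- Let $\mathrm{GL}_2(\mathbb R)$ be the group of invertible real $2\times 2$ matrices, $\mathrm O(2)$ its subgroup of orthogonal matrices and $\mathfrak{gl}_2(\mathbb R)$ its Lie algebra. A character of $\mathbb R^\times$ is a continuous homomorphism $\chi:\mathbb R^\times\to\mathbb C^\times$, and $\omega_{\mathbb R}(t)=t/|t|$ is the quadratic character of $\mathbb R^\times$. For characters $\chi_1,\chi_2$ of $\mathbb R^\times$, the principal series representation $\chi_1\times\chi_2$ of $\mathrm{GL}_2(\mathbb R)$ is the $(\mathfrak{gl}_2(\mathbb R),\mathrm O(2))$-module of all smooth functions $f:\mathrm{GL}_2(\mathbb R)\to\mathbb C$ which are right $\mathrm O(2)$-finite (their right translates by $\mathrm O(2)$ span a finite-dimensional space) and satisfy $$f\left(\begin{pmatrix} a & x\\ 0 & d\end{pmatrix} g\right)=\chi_1(a)\,\chi_2(d)\,\left|\frac ad\right|^{1/2} f(g)\qquad (a,d\in\mathbb R^\times,\ x\in\mathbb R,\ g\in\mathrm{GL}_2(\mathbb R)),$$ where $\mathrm O(2)$ acts by right translation and $\mathfrak{gl}_2(\mathbb R)$ by its derivative, $(Xf)(g)=\frac{d}{dt}\big|_{t=0}f(g\exp(tX))$.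 It is reducible if it has a nonzero proper subspace stable under $\mathfrak{gl}_2(\mathbb R)$ and $\mathrm O(2)$, and irreducible if it is nonzero and has no such subspace. (a) Let $\chi_1,\chi_2$ be characters of $\mathbb R^\times$ such that, for some integer $p\neq 0$, $\chi_1(t)/\chi_2(t)=t^p$ for all $t>0$. Then exactly one of the two principal series representations $\chi_1\times\chi_2$ and $\chi_1\times\chi_2\omega_{\mathbb R}$ of $\mathrm{GL}_2(\mathbb R)$ is reducible, and the other is irreducible. (b) For any three characters $\chi_1,\chi_2,\chi_3$ of $\mathbb R^\times$, at least one of the three principal series representations $\chi_1\times\chi_2$, $\chi_1\times\chi_3$, $\chi_2\times\chi_3$ of $\mathrm{GL}_2(\mathbb R)$ is irreducible. -/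

import Mathlib

open scoped ContDiff

namespace GL2R

/-- Continuous characters of the multiplicative group of the reals. -/
abbrev RChar := ℝˣ →ₜ* ℂˣ

/-- The quadratic character `t ↦ t / |t|` of the multiplicative group of the reals. -/
noncomputable def omega : RChar where
  toFun t := Units.mk0 (((t : ℝ) / |(t : ℝ)| : ℝ) : ℂ) (by
    have := t.ne_zero
    have := abs_ne_zero.mpr this
    simp [*])
  map_one' := by ext; simp
  map_mul' s t := by
    ext
    simp only [Units.val_mul, abs_mul, Units.val_mk0]
    push_cast
    exact mul_div_mul_comm _ _ _ _
  continuous_toFun := by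
    rw [Units.isEmbedding_val₀.continuous_iff]
    change Continuous fun t : ℝˣ => (((t : ℝ) / |(t : ℝ)| : ℝ) : ℂ)
    refine Complex.continuous_ofReal.comp ?_
    exact Units.continuous_val.div Units.continuous_val.abs
      fun t => abs_ne_zero.mpr t.ne_zero

/-- Real `2 × 2` matrices as a normed space (all norms on it are equivalent). -/
abbrev Mat := Fin 2 → Fin 2 → ℝ

/-- The group `GL₂(ℝ)`. -/
abbrev G := GL (Fin 2) ℝ

/-- The open set of invertible matrices. -/
def invertibles : Set Mat := {M | (Matrix.of M).det ≠ 0}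

/-- The entries of an element of `GL₂(ℝ)`. -/
def entries (g : G) : Mat := Matrix.of.symm g.val

/-- Extension by zero of a function on `GL₂(ℝ)` to all real `2 × 2` matrices. -/
noncomputable def extend (f : G → ℂ) : Mat → ℂ := Function.extend entries f 0

/-- Smooth functions on `GL₂(ℝ)`, an open subset of the space of matrices. -/
def Smooth (f : G → ℂ) : Prop := ContDiffOn ℝ ∞ (extend f) invertibles

/-- Right translation, `(R(h) f)(g) = f(g h)`. -/
def rightTranslate (h : G) : (G → ℂ) →ₗ[ℂ] (G → ℂ) where
  toFun f g := f (g * h)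
  map_add' _ _ := rfl
  map_smul' _ _ := rfl

/-- The action of `X` in the Lie algebra `𝔤𝔩₂(ℝ)` on smooth functions by differentiation of right
translation: the derivative of `f` at `g` in the direction `g X`, that is, the derivative of
`f(g exp(tX))` at `t = 0`. -/
noncomputable def lieAct (X : Matrix (Fin 2) (Fin 2) ℝ) (f : G → ℂ) : G → ℂ :=
  fun g => fderiv ℝ (extend f) (entries g) (Matrix.of.symm (g.val * X))

/-- The maximal compact subgroup `O(2)` of `GL₂(ℝ)`. -/
def K : Set G := {k | k.val ∈ Matrix.orthogonalGroup (Fin 2) ℝ}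

/-- The span of the right translates of `f` under `O(2)`. -/
def kSpan (f : G → ℂ) : Submodule ℂ (G → ℂ) :=
  Submodule.span ℂ ((fun k => rightTranslate k f) '' K)

/-- Right `O(2)`-finite functions. -/
def KFinite (f : G → ℂ) : Prop := FiniteDimensional ℂ (kSpan f)

/-- The upper triangular matrix with rows `(a, x)` and `(0, d)`. -/
noncomputable def upper (a d : ℝˣ) (x : ℝ) : G :=
  Matrix.GeneralLinearGroup.mkOfDetNeZero !![(a : ℝ), x; 0, (d : ℝ)]
    (by simp [Matrix.det_fin_two_of])

/-- The transformation law of normalized induction of the character `χ₁ ⊗ χ₂` from the upper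
triangular subgroup. -/
def Equivariant (χ₁ χ₂ : RChar) (f : G → ℂ) : Prop :=
  ∀ (a d : ℝˣ) (x : ℝ) (g : G),
    f (upper a d x * g) =
      (χ₁ a : ℂ) * (χ₂ d : ℂ) * (Real.sqrt |(a : ℝ) / (d : ℝ)| : ℂ) * f g

theorem entries_injective : Function.Injective entries := fun _ _ h =>
  Units.ext (Matrix.of.symm.injective h)

theorem extend_entries (f : G → ℂ) (g : G) : extend f (entries g) = f g :=
  entries_injective.extend_apply f 0 g

theorem isOpen_invertibles : IsOpen invertibles := by
  have h : Continuous fun M : Mat => (Matrix.of M).det := by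
    simp only [Matrix.det_fin_two, Matrix.of_apply]
    fun_prop
  exact h.isOpen_preimage _ isOpen_compl_singleton

theorem entries_mem (g : G) : entries g ∈ invertibles :=
  ((Matrix.isUnit_iff_isUnit_det _).mp g.isUnit).ne_zero

theorem exists_entries {M : Mat} (h : M ∈ invertibles) : ∃ g, entries g = M :=
  ⟨Matrix.GeneralLinearGroup.mkOfDetNeZero (Matrix.of M) h, rfl⟩

theorem extend_add (f f' : G → ℂ) : extend (f + f') = extend f + extend f' := by
  have := Function.extend_add entries f f' 0 0
  simpa [extend] using this

theorem extend_smul (c : ℂ) (f : G → ℂ) : extend (c • f) = c • extend f := by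
  have := Function.extend_smul c entries f 0
  simpa [extend] using this

/-- Smooth functions form a subspace. -/
def smoothSubmodule : Submodule ℂ (G → ℂ) where
  carrier := {f | Smooth f}
  zero_mem' := by
    have h : extend 0 = fun _ => 0 := by
      have := extend_smul 0 0
      rw [zero_smul, zero_smul] at this
      exact this
    change ContDiffOn ℝ ∞ (extend 0) invertibles
    rw [h]
    exact contDiffOn_const
  add_mem' {f f'} hf hf' := by
    change ContDiffOn ℝ ∞ (extend (f + f')) invertibles
    rw [extend_add]
    exact ContDiffOn.add hf hf'
  smul_mem' c f hf := by
    change ContDiffOn ℝ ∞ (extend (c • f)) invertibles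
    rw [extend_smul]
    exact ContDiffOn.const_smul c hf

theorem rightTranslate_mem_kSpan (f : G → ℂ) {k : G} (hk : k ∈ K) :
    rightTranslate k f ∈ kSpan f := Submodule.subset_span ⟨k, hk, rfl⟩

theorem KFinite.of_le {f : G → ℂ} {S : Submodule ℂ (G → ℂ)} (hS : FiniteDimensional ℂ S)
    (h : ∀ k ∈ K, rightTranslate k f ∈ S) : KFinite f := by
  have hle : kSpan f ≤ S := by
    rw [kSpan, Submodule.span_le]
    rintro _ ⟨k, hk, rfl⟩
    exact h k hk
  exact Submodule.finiteDimensional_of_le hle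

/-- The space of the principal series representation `χ₁ × χ₂` of `GL₂(ℝ)`: smooth, right
`O(2)`-finite functions satisfying the transformation law of normalized induction. -/
def principalSeries (χ₁ χ₂ : RChar) : Submodule ℂ (G → ℂ) where
  carrier := {f | Smooth f ∧ KFinite f ∧ Equivariant χ₁ χ₂ f}
  zero_mem' := by
    refine ⟨smoothSubmodule.zero_mem, ?_, fun a d x g => by simp⟩
    exact KFinite.of_le (S := ⊥) inferInstance fun k _ => by simp
  add_mem' {f f'} hf hf' := by
    refine ⟨smoothSubmodule.add_mem hf.1 hf'.1, ?_, fun a d x g => ?_⟩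
    · have := hf.2.1
      have := hf'.2.1
      unfold KFinite at *
      refine KFinite.of_le (S := kSpan f ⊔ kSpan f') inferInstance fun k hk => ?_
      rw [map_add]
      exact Submodule.add_mem_sup (rightTranslate_mem_kSpan f hk)
        (rightTranslate_mem_kSpan f' hk)
    · simp only [Pi.add_apply, hf.2.2 a d x g, hf'.2.2 a d x g]
      ring
  smul_mem' c f hf := by
    refine ⟨smoothSubmodule.smul_mem c hf.1, ?_, fun a d x g => ?_⟩
    · refine KFinite.of_le hf.2.1 fun k hk => ?_
      rw [map_smul]
      exact Submodule.smul_mem _ c (rightTranslate_mem_kSpan f hk)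
    · simp only [Pi.smul_apply, smul_eq_mul, hf.2.2 a d x g]
      ring

/-- Stability of a space of functions under the actions of the Lie algebra `𝔤𝔩₂(ℝ)` and of
`O(2)`. -/
def IsStable (W : Submodule ℂ (G → ℂ)) : Prop :=
  (∀ (X : Matrix (Fin 2) (Fin 2) ℝ), ∀ f ∈ W, lieAct X f ∈ W) ∧
    ∀ k ∈ K, ∀ f ∈ W, rightTranslate k f ∈ W

/-- Right multiplication by a matrix. -/
noncomputable def mulRight (X : Matrix (Fin 2) (Fin 2) ℝ) : Mat →L[ℝ] Mat :=
  LinearMap.toContinuousLinearMap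
    { toFun := fun M => Matrix.of.symm (Matrix.of M * X)
      map_add' := fun M N => by
        change Matrix.of.symm ((Matrix.of M + Matrix.of N) * X) = _
        rw [add_mul]; rfl
      map_smul' := fun c M => by
        change Matrix.of.symm ((c • Matrix.of M) * X) = _
        rw [smul_mul_assoc]; rfl }

/-- Left multiplication by a matrix. -/
noncomputable def mulLeft (X : Matrix (Fin 2) (Fin 2) ℝ) : Mat →L[ℝ] Mat :=
  LinearMap.toContinuousLinearMap
    { toFun := fun M => Matrix.of.symm (X * Matrix.of M)
      map_add' := fun M N => by
        change Matrix.of.symm (X * (Matrix.of M + Matrix.of N)) = _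
        rw [mul_add]; rfl
      map_smul' := fun c M => by
        change Matrix.of.symm (X * (c • Matrix.of M)) = _
        rw [mul_smul_comm]; rfl }

theorem mulRight_entries (g h : G) : mulRight h.val (entries g) = entries (g * h) := rfl

theorem mulLeft_entries (g h : G) : mulLeft h.val (entries g) = entries (h * g) := rfl

theorem Smooth.differentiableAt {f : G → ℂ} (hf : Smooth f) (g : G) :
    DifferentiableAt ℝ (extend f) (entries g) :=
  (hf.contDiffAt (isOpen_invertibles.mem_nhds (entries_mem g))).differentiableAt (by simp)

theorem extend_rightTranslate {f : G → ℂ} (k : G) :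
    Set.EqOn (extend (rightTranslate k f)) (extend f ∘ mulRight k.val) invertibles := by
  intro M hM
  obtain ⟨g, rfl⟩ := exists_entries hM
  rw [extend_entries, Function.comp_apply, mulRight_entries, extend_entries]
  rfl

theorem Smooth.rightTranslate {f : G → ℂ} (hf : Smooth f) (k : G) :
    Smooth (rightTranslate k f) := by
  refine ContDiffOn.congr ?_ (extend_rightTranslate k)
  refine ContDiffOn.comp hf (mulRight k.val).contDiff.contDiffOn fun M hM => ?_
  obtain ⟨g, rfl⟩ := exists_entries hM
  exact entries_mem (g * k)

theorem Smooth.lieAct {f : G → ℂ} (hf : Smooth f) (X : Matrix (Fin 2) (Fin 2) ℝ) :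
    Smooth (lieAct X f) := by
  have h1 : ContDiffOn ℝ ∞ (fderiv ℝ (extend f)) invertibles :=
    ContDiffOn.fderiv_of_isOpen hf isOpen_invertibles (by simp)
  refine (h1.clm_apply (mulRight X).contDiff.contDiffOn).congr fun M hM => ?_
  obtain ⟨g, rfl⟩ := exists_entries hM
  rw [extend_entries]
  rfl

theorem lieAct_rightTranslate {f : G → ℂ} (hf : Smooth f) (k : G)
    (X : Matrix (Fin 2) (Fin 2) ℝ) :
    rightTranslate k (lieAct X f) =
      lieAct (k.val * X * (k⁻¹).val) (rightTranslate k f) := by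
  funext g
  have h1 : extend (rightTranslate k f) =ᶠ[nhds (entries g)] extend f ∘ mulRight k.val :=
    (extend_rightTranslate k).eventuallyEq_of_mem (isOpen_invertibles.mem_nhds (entries_mem g))
  change fderiv ℝ (extend f) (entries (g * k)) _ =
    fderiv ℝ (extend (rightTranslate k f)) (entries g) _
  rw [h1.fderiv_eq, fderiv_comp (f := mulRight k.val) (entries g) (hf.differentiableAt (g * k))
    (mulRight k.val).differentiableAt, ContinuousLinearMap.fderiv]
  change _ = fderiv ℝ (extend f) (entries (g * k)) (mulRight k.val _)
  congr 1
  change Matrix.of.symm _ = Matrix.of.symm (g.val * (k.val * X * (k⁻¹).val) * k.val)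
  simp [mul_assoc]

/-- The action of an element of the Lie algebra, as a linear map on smooth functions. -/
noncomputable def lieActLinear (X : Matrix (Fin 2) (Fin 2) ℝ) :
    smoothSubmodule →ₗ[ℂ] (G → ℂ) where
  toFun f := lieAct X f.1
  map_add' f f' := by
    funext g
    change fderiv ℝ (extend (f.1 + f'.1)) (entries g) _ = _
    rw [extend_add, fderiv_add (Smooth.differentiableAt f.2 g) (Smooth.differentiableAt f'.2 g)]
    rfl
  map_smul' c f := by
    funext g
    change fderiv ℝ (extend (c • f.1)) (entries g) _ = _
    rw [extend_smul, fderiv_const_smul (Smooth.differentiableAt f.2 g)]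
    rfl

theorem lieAct_eq_sum (X : Matrix (Fin 2) (Fin 2) ℝ) (f : G → ℂ) :
    lieAct X f = ∑ p : Fin 2 × Fin 2,
      (X p.1 p.2 : ℂ) • lieAct (Matrix.single p.1 p.2 1) f := by
  funext g
  have hX : X = ∑ p : Fin 2 × Fin 2, X p.1 p.2 • Matrix.single p.1 p.2 (1 : ℝ) := by
    rw [Fintype.sum_prod_type]
    conv_lhs => rw [Matrix.matrix_eq_sum_single X]
    simp [Matrix.smul_single]
  have hl : ∀ Y : Matrix (Fin 2) (Fin 2) ℝ,
      lieAct Y f g = fderiv ℝ (extend f) (entries g) (mulLeft g.val Y) := fun _ => rfl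
  rw [Finset.sum_apply]
  simp only [Pi.smul_apply, hl]
  conv_lhs => rw [hX]
  erw [map_sum, map_sum]
  refine Finset.sum_congr rfl fun p _ => ?_
  erw [map_smul, map_smul]
  rw [Complex.real_smul, smul_eq_mul]

theorem KFinite.lieAct {f : G → ℂ} (hs : Smooth f) (hf : KFinite f)
    (X : Matrix (Fin 2) (Fin 2) ℝ) : KFinite (lieAct X f) := by
  have hfin : FiniteDimensional ℂ (kSpan f) := hf
  have hle : kSpan f ≤ smoothSubmodule := by
    rw [kSpan, Submodule.span_le]
    rintro _ ⟨k, -, rfl⟩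
    exact hs.rightTranslate k
  let L : Fin 2 × Fin 2 → kSpan f →ₗ[ℂ] (G → ℂ) := fun p =>
    lieActLinear (Matrix.single p.1 p.2 1) ∘ₗ Submodule.inclusion hle
  refine KFinite.of_le (S := ⨆ p, LinearMap.range (L p)) inferInstance fun k hk => ?_
  rw [lieAct_rightTranslate hs, lieAct_eq_sum]
  refine Submodule.sum_mem _ fun p _ => Submodule.smul_mem _ _ ?_
  exact Submodule.mem_iSup_of_mem p ⟨⟨_, rightTranslate_mem_kSpan f hk⟩, rfl⟩

theorem Equivariant.lieAct {χ₁ χ₂ : RChar} {f : G → ℂ} (hs : Smooth f)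
    (hf : Equivariant χ₁ χ₂ f) (X : Matrix (Fin 2) (Fin 2) ℝ) :
    Equivariant χ₁ χ₂ (lieAct X f) := by
  intro a d x g
  set b := upper a d x
  set c : ℂ := (χ₁ a : ℂ) * (χ₂ d : ℂ) * (Real.sqrt |(a : ℝ) / (d : ℝ)| : ℂ)
  have h : Set.EqOn (extend f ∘ mulLeft b.val) (c • extend f) invertibles := by
    intro M hM
    obtain ⟨g, rfl⟩ := exists_entries hM
    rw [Function.comp_apply, mulLeft_entries, Pi.smul_apply, extend_entries, extend_entries]
    exact hf a d x g
  have h1 := (h.eventuallyEq_of_mem (isOpen_invertibles.mem_nhds (entries_mem g))).fderiv_eq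
    (𝕜 := ℝ)
  rw [fderiv_comp (f := mulLeft b.val) (entries g)
    (hs.differentiableAt (b * g)) (mulLeft b.val).differentiableAt,
    ContinuousLinearMap.fderiv, fderiv_const_smul (hs.differentiableAt g)] at h1
  have h2 := DFunLike.congr_fun h1 (Matrix.of.symm (g.val * X))
  refine Eq.trans ?_ h2
  change fderiv ℝ (extend f) (entries (b * g)) (Matrix.of.symm (b.val * g.val * X)) =
    fderiv ℝ (extend f) (entries (b * g)) (Matrix.of.symm (b.val * (g.val * X)))
  rw [mul_assoc]

/-- The principal series is stable under the Lie algebra and `O(2)`. -/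
theorem principalSeries_isStable (χ₁ χ₂ : RChar) : IsStable (principalSeries χ₁ χ₂) := by
  refine ⟨fun X f hf => ⟨hf.1.lieAct X, hf.2.1.lieAct hf.1 X, hf.2.2.lieAct hf.1 X⟩,
    fun k hk f hf => ⟨hf.1.rightTranslate k, ?_, fun a d x g => ?_⟩⟩
  · refine KFinite.of_le hf.2.1 fun l hl => ?_
    have h := rightTranslate_mem_kSpan f (k := l * k)
      ((Matrix.orthogonalGroup (Fin 2) ℝ).mul_mem hl hk)
    have e : rightTranslate (l * k) f = rightTranslate l (rightTranslate k f) := by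
      funext g
      exact congrArg f (mul_assoc g l k).symm
    rwa [← e]
  · change f (_ * g * k) = _
    rw [mul_assoc]
    exact hf.2.2 a d x (g * k)

/-- The principal series `χ₁ × χ₂` is irreducible: it is nonzero, and its only subspaces stable
under the Lie algebra and `O(2)` are zero and the whole space. -/
def IsIrreducible (χ₁ χ₂ : RChar) : Prop :=
  principalSeries χ₁ χ₂ ≠ ⊥ ∧
    ∀ W ≤ principalSeries χ₁ χ₂, IsStable W → W = ⊥ ∨ W = principalSeries χ₁ χ₂

/-- The principal series `χ₁ × χ₂` is reducible: it has a nonzero proper subspace stable under the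
Lie algebra and `O(2)`. -/
def IsReducible (χ₁ χ₂ : RChar) : Prop :=
  ∃ W ≤ principalSeries χ₁ χ₂, IsStable W ∧ W ≠ ⊥ ∧ W ≠ principalSeries χ₁ χ₂

end GL2R

/-! Write `χᵢ(t) = t ^ sᵢ` for `t > 0` and `s = s₁ - s₂`. By the Iwasawa decomposition an element of
`χ₁ × χ₂` is determined by its restriction to `SO(2)`. `O(2)`-finiteness makes the Fourier series of
this restriction finite, so the space has as basis the explicit functions `weightFun χ₁ s n`, one
for each integer `n` with `(-1) ^ n = χ₁(-1) χ₂(-1)`.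

The Lie algebra moves weight `n` to `n + 2` with coefficient proportional to `s + 1 + n` and to `n -
2` with coefficient proportional to `s + 1 - n` (`lieAct_weightFun`), and the reflection exchanges
`n` and `-n`. A stable subspace is spanned by weight functions, so everything depends on whether `n
= -(s + 1)` is a weight. If it is not, every weight is reached from every other one. If it is and `n
≠ -1`, the ladder breaks and a proper stable subspace appears. For `n = -1` the broken step from
`-1` to `1` is repaired by the reflection. See `isIrreducible_of_forall` and
`isReducible_of_weight`.

For (a), `s = p ≠ 0`, so the critical integer is `-p - 1 ≠ -1`. Twisting by `omega` exchanges even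
and odd weights, so it is a weight of exactly one of the two representations. For (b), if all three
representations were reducible, the critical weights `a, b, c` of the pairs `(1,2), (1,3), (2,3)`
would satisfy `b = a + c + 1`, whereas the signs at `-1` force `b ≡ a + c` modulo `2`. -/

namespace GL2R

/-! ### Exponents of characters of the multiplicative group of the reals -/

/-- A continuous solution of `c (x + y) = c x * c y` with `c 0 = 1` is an exponential. -/
theorem exists_eq_exp_of_continuous {c : ℝ → ℂ} (hc : Continuous c) (h0 : c 0 = 1)
    (hadd : ∀ x y, c (x + y) = c x * c y) : ∃ s : ℂ, ∀ x : ℝ, c x = Complex.exp (s * x) := by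
  set F : ℝ → ℂ := fun x => ∫ t in (0 : ℝ)..x, c t with hF
  have hF' : ∀ x, HasDerivAt F (c x) x := fun x =>
    intervalIntegral.integral_hasDerivAt_right (hc.intervalIntegrable _ _)
      (hc.stronglyMeasurableAtFilter _ _) hc.continuousAt
  obtain ⟨δ, hδ⟩ : ∃ δ, F δ ≠ 0 := by
    by_contra! h
    have h1 : F = fun _ => 0 := funext h
    have h2 := hF' 0
    rw [h1] at h2
    exact one_ne_zero (h0 ▸ h2.unique (hasDerivAt_const (0 : ℝ) (0 : ℂ)))
  -- Integrating `c (x + t) = c x * c t` over `t` from `0` to `δ` expresses `c` through its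
  -- primitive, so continuity of `c` already gives differentiability.
  have hcF : ∀ x, c x = (F (x + δ) - F x) / F δ := by
    intro x
    rw [eq_div_iff hδ]
    have h1 : F (x + δ) - F x = ∫ t in x..(x + δ), c t :=
      intervalIntegral.integral_interval_sub_left (hc.intervalIntegrable _ _)
        (hc.intervalIntegrable _ _)
    have h2 : ∫ t in x..(x + δ), c t = ∫ t in (0 : ℝ)..δ, c (x + t) := by
      rw [intervalIntegral.integral_comp_add_left (fun t => c t) x, add_zero]
    rw [h1, h2]
    simp only [hadd, intervalIntegral.integral_const_mul, hF]
  set s : ℂ := (c δ - 1) / F δ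
  have hd : ∀ x, HasDerivAt c (s * c x) x := by
    intro x
    have h1 := (((hF' (x + δ)).comp_add_const x δ).sub (hF' x)).div_const (F δ)
    have h2 : c = fun x => (F (x + δ) - F x) / F δ := funext hcF
    rw [hadd] at h1
    have h3 : s * c x = (c x * c δ - c x) / F δ := by simp only [s]; ring
    rw [h3]
    nth_rewrite 1 [h2]
    exact h1
  have he : ∀ x : ℝ, HasDerivAt (fun x : ℝ => Complex.exp (-s * x)) (Complex.exp (-s * x) * -s) x := by
    intro x
    have := ((hasDerivAt_id (x : ℂ)).const_mul (-s)).cexp.comp_ofReal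
    simpa using this
  refine ⟨s, fun x => ?_⟩
  have hconst : c x * Complex.exp (-s * x) = c 0 * Complex.exp (-s * (0 : ℝ)) := by
    have hp : ∀ x, HasDerivAt (fun x : ℝ => c x * Complex.exp (-s * x)) 0 x := fun x =>
      ((hd x).mul (he x)).congr_deriv (by ring)
    exact is_const_of_deriv_eq_zero (fun x => (hp x).differentiableAt) (fun x => (hp x).deriv) x 0
  rw [h0, Complex.ofReal_zero, mul_zero, Complex.exp_zero, mul_one] at hconst
  calc c x = c x * Complex.exp (-s * x) * Complex.exp (s * x) := by
        rw [mul_assoc, ← Complex.exp_add]; simp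
    _ = _ := by rw [hconst, one_mul]

/-- The restriction of `χ` to the positive reals is `t ↦ t ^ s`. -/
def HasExponent (χ : RChar) (s : ℂ) : Prop :=
  ∀ t : ℝˣ, 0 < (t : ℝ) → (χ t : ℂ) = Complex.exp (s * Real.log t)

theorem exists_hasExponent (χ : RChar) : ∃ s, HasExponent χ s := by
  let u : ℝ → ℝˣ := fun x => Units.mk0 (Real.exp x) (Real.exp_ne_zero x)
  have hu : Continuous u := by
    rw [Units.isEmbedding_val₀.continuous_iff]
    exact Real.continuous_exp
  obtain ⟨s, hs⟩ := exists_eq_exp_of_continuous (c := fun x => (χ (u x) : ℂ))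
    (Units.continuous_val.comp (χ.continuous_toFun.comp hu))
    (by
      have : u 0 = 1 := by ext; simp [u]
      simp [this])
    (fun x y => by
      have : u (x + y) = u x * u y := by ext; simp [u, Real.exp_add]
      simp [this])
  refine ⟨s, fun t ht => ?_⟩
  rw [← hs]
  congr 2
  ext
  simp [u, Real.exp_log ht]

/-- `Real.log t` is `log |t|` for negative `t`, so the exponential is the value of `χ` at `-t`. -/
theorem HasExponent.neg {χ : RChar} {s : ℂ} (h : HasExponent χ s) {t : ℝˣ} (ht : (t : ℝ) < 0) :
    (χ t : ℂ) = χ (-1) * Complex.exp (s * Real.log t) := by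
  have h1 : t = -1 * -t := by simp
  conv_lhs => rw [h1, map_mul]
  rw [Units.val_mul, h (-t) (by simpa using ht)]
  simp

theorem RChar.sq_neg_one (χ : RChar) : (χ (-1) : ℂ) * χ (-1) = 1 := by
  rw [← Units.val_mul, ← map_mul]
  simp

theorem RChar.neg_one_eq (χ : RChar) : (χ (-1) : ℂ) = 1 ∨ (χ (-1) : ℂ) = -1 :=
  mul_self_eq_one_iff.mp χ.sq_neg_one

theorem omega_apply (t : ℝˣ) : (omega t : ℂ) = (((t : ℝ) / |(t : ℝ)| : ℝ) : ℂ) := rfl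

theorem omega_neg_one : (omega (-1) : ℂ) = -1 := by
  simp [omega_apply]

theorem HasExponent.mul_omega {χ : RChar} {s : ℂ} (h : HasExponent χ s) :
    HasExponent (χ * omega) s := by
  intro t ht
  have h1 : (omega t : ℂ) = 1 := by
    rw [omega_apply, abs_of_pos ht, div_self ht.ne', Complex.ofReal_one]
  have h2 : (χ * omega) t = χ t * omega t := rfl
  rw [h2, Units.val_mul, h1, mul_one, h t ht]

/-! ### Explicit functions of given weight under `SO(2)` -/

/-- The bottom row `(c, d)` of a matrix, encoded as `d - i c`. -/
noncomputable def low (M : Mat) : ℂ := (M 1 1 : ℂ) - Complex.I * (M 1 0 : ℂ)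

/-- The squared length of the bottom row. -/
noncomputable def lowSq (M : Mat) : ℝ := M 1 0 ^ 2 + M 1 1 ^ 2

theorem low_mul_conj (M : Mat) :
    low M * (starRingEnd ℂ) (low M) = (lowSq M : ℂ) := by
  simp only [low, lowSq, map_sub, map_mul, Complex.conj_I, Complex.conj_ofReal]
  push_cast
  linear_combination (-(M 1 0 : ℂ) ^ 2) * Complex.I_sq

theorem lowSq_pos (g : G) : 0 < lowSq (entries g) := by
  have h := entries_mem g
  have h1 : entries g 0 0 * entries g 1 1 - entries g 0 1 * entries g 1 0 ≠ 0 := by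
    have h2 : (Matrix.of (entries g)).det ≠ 0 := h
    rwa [Matrix.det_fin_two] at h2
  by_contra hn
  have h3 : entries g 1 0 = 0 ∧ entries g 1 1 = 0 := by
    unfold lowSq at hn
    constructor <;> nlinarith [sq_nonneg (entries g 1 0), sq_nonneg (entries g 1 1)]
  exact h1 (by rw [h3.1, h3.2]; ring)

theorem low_ne_zero (g : G) : low (entries g) ≠ 0 := by
  intro h
  have := low_mul_conj (entries g)
  rw [h, zero_mul] at this
  exact (lowSq_pos g).ne' (by exact_mod_cast this.symm)

/-- The function `|w| ^ (-(s + 1 + n)) * w ^ n` of the bottom row `w`. -/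
noncomputable def lowWeight (s : ℂ) (n : ℤ) (M : Mat) : ℂ :=
  Complex.exp (-((s + 1 + n) / 2) * Real.log (lowSq M)) * low M ^ n

/-- The function on `GL₂(ℝ)` of weight `n` under `SO(2)` which spans the corresponding isotypic
part of the principal series. -/
noncomputable def weightFun (χ : RChar) (s : ℂ) (n : ℤ) (g : G) : ℂ :=
  (χ (Matrix.GeneralLinearGroup.det g) : ℂ) *
    Complex.exp (1 / 2 * Real.log (Matrix.GeneralLinearGroup.det g : ℝˣ)) *
    lowWeight s n (entries g)

/-- The matrix of rotation by `θ`. -/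
noncomputable def rot (θ : ℝ) : G :=
  Matrix.GeneralLinearGroup.mkOfDetNeZero
    !![Real.cos θ, Real.sin θ; -Real.sin θ, Real.cos θ] (by
      rw [Matrix.det_fin_two_of]
      have := Real.cos_sq_add_sin_sq θ
      have h : Real.cos θ * Real.cos θ - Real.sin θ * -Real.sin θ = 1 := by linarith
      rw [h]
      exact one_ne_zero)

/-- The reflection `diag(-1, 1)`. -/
noncomputable def refl : G :=
  Matrix.GeneralLinearGroup.mkOfDetNeZero !![-1, 0; 0, 1] (by simp)

theorem det_rot (θ : ℝ) : Matrix.GeneralLinearGroup.det (rot θ) = 1 := by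
  ext
  change Matrix.det !![Real.cos θ, Real.sin θ; -Real.sin θ, Real.cos θ] = 1
  rw [Matrix.det_fin_two_of]
  linarith [Real.cos_sq_add_sin_sq θ]

theorem det_refl : Matrix.GeneralLinearGroup.det refl = -1 := by
  ext
  change Matrix.det !![(-1 : ℝ), 0; 0, 1] = -1
  simp

theorem det_upper (a d : ℝˣ) (x : ℝ) : Matrix.GeneralLinearGroup.det (upper a d x) = a * d := by
  ext
  change Matrix.det !![(a : ℝ), x; 0, (d : ℝ)] = a * d
  simp

theorem entries_mul_apply (g h : G) (i j : Fin 2) :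
    entries (g * h) i j = entries g i 0 * entries h 0 j + entries g i 1 * entries h 1 j := by
  change (g.val * h.val) i j = _
  rw [Matrix.mul_apply, Fin.sum_univ_two]
  rfl

/-- This is the reason for the encoding `d - i c`: a rotation of the row becomes multiplication by
`e ^ (iθ)`, so that the power `n` has weight `n`. -/
theorem low_mul_rot (g : G) (θ : ℝ) :
    low (entries (g * rot θ)) = Complex.exp (Complex.I * θ) * low (entries g) := by
  have h1 : entries (rot θ) = !![Real.cos θ, Real.sin θ; -Real.sin θ, Real.cos θ] := rfl
  rw [mul_comm Complex.I, Complex.exp_mul_I]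
  simp only [low, entries_mul_apply, h1]
  simp
  linear_combination ((entries g 1 0 : ℂ) * Complex.sin θ) * Complex.I_sq

theorem low_mul_refl (g : G) :
    low (entries (g * refl)) = (starRingEnd ℂ) (low (entries g)) := by
  have h1 : entries refl = !![-1, 0; 0, 1] := rfl
  simp only [low, entries_mul_apply, h1]
  simp

theorem low_upper_mul (a d : ℝˣ) (x : ℝ) (g : G) :
    low (entries (upper a d x * g)) = (d : ℝ) * low (entries g) := by
  have h1 : entries (upper a d x) = !![(a : ℝ), x; 0, (d : ℝ)] := rfl
  simp only [low, entries_mul_apply, h1]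
  simp
  ring

theorem lowSq_eq_normSq (M : Mat) : lowSq M = Complex.normSq (low M) := by
  rw [← Complex.ofReal_inj, ← low_mul_conj, Complex.mul_conj]

/-- With `w` the bottom row, `conj w = |w| ^ 2 / w`, and the factor `|w| ^ (2 n)` this produces
turns the exponent `-(s + 1 + n)` into `-(s + 1 - n)`. -/
theorem lowWeight_conj {s : ℂ} {n : ℤ} {M N : Mat} (hM : low M ≠ 0)
    (h : low N = (starRingEnd ℂ) (low M)) : lowWeight s n N = lowWeight s (-n) M := by
  have hsq : lowSq N = lowSq M := by
    rw [lowSq_eq_normSq, lowSq_eq_normSq, h, Complex.normSq_conj]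
  have hpos : 0 < lowSq M := by
    rw [lowSq_eq_normSq]
    exact Complex.normSq_pos.mpr hM
  have h1 : (starRingEnd ℂ) (low M) = Complex.exp (Real.log (lowSq M)) * (low M)⁻¹ := by
    rw [← Complex.ofReal_exp, Real.exp_log hpos, ← low_mul_conj]
    field_simp
  rw [lowWeight, lowWeight, hsq, h, h1, mul_zpow, inv_zpow', ← Complex.exp_int_mul, ← mul_assoc,
    ← Complex.exp_add]
  congr 2
  push_cast
  ring

/-- The factor `w ^ 2 / |w| ^ 2` equals `w / conj w`. Such quotients arise on differentiating and
are read as shifts of the weight by two. -/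
theorem lowWeight_add_two (s : ℂ) (n : ℤ) {M : Mat} (hM : low M ≠ 0) :
    lowWeight s (n + 2) M = lowWeight s n M * (low M / (starRingEnd ℂ) (low M)) := by
  have hpos : 0 < lowSq M := by
    rw [lowSq_eq_normSq]
    exact Complex.normSq_pos.mpr hM
  have hc : (starRingEnd ℂ) (low M) ≠ 0 := by simpa using hM
  have h1 : Complex.exp (-(Real.log (lowSq M))) = (low M * (starRingEnd ℂ) (low M))⁻¹ := by
    rw [Complex.exp_neg, ← Complex.ofReal_exp, Real.exp_log hpos, ← low_mul_conj]
  have h2 : -((s + 1 + ((n + 2 : ℤ) : ℂ)) / 2) * (Real.log (lowSq M) : ℂ) =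
      -((s + 1 + n) / 2) * Real.log (lowSq M) + -(Real.log (lowSq M)) := by
    push_cast
    ring
  rw [lowWeight, lowWeight, h2, Complex.exp_add, h1, zpow_add₀ hM]
  field_simp

theorem lowWeight_sub_two (s : ℂ) (n : ℤ) {M : Mat} (hM : low M ≠ 0) :
    lowWeight s (n - 2) M = lowWeight s n M * ((starRingEnd ℂ) (low M) / low M) := by
  have hc : (starRingEnd ℂ) (low M) ≠ 0 := by simpa using hM
  have h := lowWeight_add_two s (n - 2) hM
  rw [sub_add_cancel] at h
  rw [h]
  field_simp

theorem rightTranslate_rot_weightFun (χ : RChar) (s : ℂ) (n : ℤ) (θ : ℝ) :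
    rightTranslate (rot θ) (weightFun χ s n) =
      Complex.exp (Complex.I * (n * θ)) • weightFun χ s n := by
  funext g
  change weightFun χ s n (g * rot θ) = Complex.exp (Complex.I * (n * θ)) * weightFun χ s n g
  have h1 : lowSq (entries (g * rot θ)) = lowSq (entries g) := by
    rw [lowSq_eq_normSq, lowSq_eq_normSq, low_mul_rot, map_mul, Complex.normSq_eq_norm_sq
      (Complex.exp _), mul_comm Complex.I, Complex.norm_exp_ofReal_mul_I]
    ring
  rw [weightFun, weightFun, map_mul, det_rot, mul_one, lowWeight, lowWeight, h1, low_mul_rot,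
    mul_zpow, ← Complex.exp_int_mul, show (n : ℂ) * (Complex.I * θ) = Complex.I * (n * θ) by ring]
  ring

theorem rightTranslate_refl_weightFun (χ : RChar) (s : ℂ) (n : ℤ) :
    rightTranslate refl (weightFun χ s n) = (χ (-1) : ℂ) • weightFun χ s (-n) := by
  funext g
  change weightFun χ s n (g * refl) = (χ (-1) : ℂ) * weightFun χ s (-n) g
  rw [weightFun, weightFun, map_mul, det_refl, map_mul,
    lowWeight_conj (low_ne_zero g) (low_mul_refl g)]
  simp
  ring

theorem weightFun_rot (χ : RChar) (s : ℂ) (n : ℤ) (θ : ℝ) :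
    weightFun χ s n (rot θ) = Complex.exp (Complex.I * (n * θ)) := by
  have h := congrFun (rightTranslate_rot_weightFun χ s n θ) 1
  change weightFun χ s n (1 * rot θ) = Complex.exp (Complex.I * (n * θ)) * weightFun χ s n 1 at h
  have h1 : entries 1 = !![1, 0; 0, 1] := Matrix.one_fin_two
  have h2 : weightFun χ s n 1 = 1 := by
    simp [weightFun, lowWeight, low, lowSq, h1]
  rw [one_mul, h2, mul_one] at h
  exact h

theorem sqrt_eq_exp_log {x : ℝ} (hx : x ≠ 0) :
    (Real.sqrt |x| : ℂ) = Complex.exp (1 / 2 * Real.log x) := by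
  have h : Real.sqrt |x| = Real.exp (1 / 2 * Real.log x) := by
    rw [← Real.log_abs, Real.sqrt_eq_rpow, Real.rpow_def_of_pos (abs_pos.mpr hx), mul_comm]
  rw [h]
  push_cast
  rfl

/-- The scalar `t` may be negative: its sign is carried by `t ^ n` alone, as `Real.log t` is `log
|t|`. -/
theorem lowWeight_mul (s : ℂ) (n : ℤ) {t : ℝ} (ht : t ≠ 0) {M N : Mat} (hM : low M ≠ 0)
    (h : low N = t * low M) : lowWeight s n N =
      Complex.exp (-(s + 1 + n) * Real.log t) * (t : ℂ) ^ n * lowWeight s n M := by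
  have hpos : 0 < lowSq M := by
    rw [lowSq_eq_normSq]
    exact Complex.normSq_pos.mpr hM
  have h1 : lowSq N = t ^ 2 * lowSq M := by
    rw [lowSq_eq_normSq, lowSq_eq_normSq, h, map_mul, Complex.normSq_ofReal]
    ring
  rw [lowWeight, lowWeight, h1, h, Real.log_mul (pow_ne_zero 2 ht) hpos.ne', Real.log_pow, mul_zpow,
    Complex.ofReal_add, mul_add, Complex.exp_add]
  push_cast
  ring_nf

/-- The determinant contributes `χ₁(ad) |ad| ^ (1/2)`, so the bottom row has to convert `χ₁(d)` into
`χ₂(d) |d|⁻¹`, which is `key`. For `d > 0` this is a matter of exponents; for `d < 0` it needs the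
parity condition on `n`. -/
theorem equivariant_weightFun {χ₁ χ₂ : RChar} {s₁ s₂ : ℂ} (h₁ : HasExponent χ₁ s₁)
    (h₂ : HasExponent χ₂ s₂) {n : ℤ} (hn : (χ₁ (-1) : ℂ) * χ₂ (-1) = (-1) ^ n) :
    Equivariant χ₁ χ₂ (weightFun χ₁ (s₁ - s₂) n) := by
  intro a d x g
  have key : (χ₁ d : ℂ) * (Complex.exp (-(s₁ - s₂ + 1 + n) * Real.log d) * ((d : ℝ) : ℂ) ^ n) =
      χ₂ d * Complex.exp (-(Real.log d)) := by
    rcases lt_or_gt_of_ne d.ne_zero with hd | hd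
    · have e : ((d : ℝ) : ℂ) = -1 * Complex.exp (Real.log d) := by
        rw [← Complex.ofReal_exp, Real.exp_log_of_neg hd]
        simp
      rw [h₁.neg hd, h₂.neg hd, e, mul_zpow, ← hn, ← Complex.exp_int_mul]
      have h3 := χ₁.sq_neg_one
      have h4 : Complex.exp (s₁ * Real.log d) *
          Complex.exp (-(s₁ - s₂ + 1 + n) * Real.log d) * Complex.exp (n * Real.log d) =
          Complex.exp (s₂ * Real.log d) * Complex.exp (-(Real.log d)) := by
        rw [← Complex.exp_add, ← Complex.exp_add, ← Complex.exp_add]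
        ring_nf
      linear_combination (χ₁ (-1) : ℂ) * χ₁ (-1) * χ₂ (-1) * h4 +
        χ₂ (-1) * (Complex.exp (s₂ * Real.log d) * Complex.exp (-(Real.log d))) * h3
    · have e : ((d : ℝ) : ℂ) = Complex.exp (Real.log d) := by
        rw [← Complex.ofReal_exp, Real.exp_log hd]
      rw [h₁ d hd, h₂ d hd]
      rw [e]
      rw [← Complex.exp_int_mul, ← Complex.exp_add, ← Complex.exp_add, ← Complex.exp_add]
      ring_nf
  rw [weightFun, weightFun, map_mul, det_upper,
    lowWeight_mul _ _ d.ne_zero (low_ne_zero g) (low_upper_mul a d x g),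
    sqrt_eq_exp_log (div_ne_zero a.ne_zero d.ne_zero), Real.log_div a.ne_zero d.ne_zero]
  simp only [map_mul, Units.val_mul]
  rw [Real.log_mul (mul_ne_zero a.ne_zero d.ne_zero) (Units.ne_zero _),
    Real.log_mul a.ne_zero d.ne_zero]
  have e1 : Complex.exp (1 / 2 * ((Real.log a - Real.log d : ℝ) : ℂ)) =
      Complex.exp (1 / 2 * ((Real.log a + Real.log d : ℝ) : ℂ)) * Complex.exp (-(Real.log d)) := by
    rw [← Complex.exp_add]
    push_cast
    ring_nf
  have e2 : ∀ y : ℝ, Complex.exp (1 / 2 * ((Real.log a + Real.log d + y : ℝ) : ℂ)) =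
      Complex.exp (1 / 2 * ((Real.log a + Real.log d : ℝ) : ℂ)) * Complex.exp (1 / 2 * y) := by
    intro y
    rw [← Complex.exp_add]
    push_cast
    ring_nf
  rw [e1, e2]
  linear_combination (χ₁ a : ℂ) * χ₁ (Matrix.GeneralLinearGroup.det g) *
    Complex.exp (1 / 2 * ((Real.log a + Real.log d : ℝ) : ℂ)) *
    Complex.exp (1 / 2 * (Real.log (Matrix.GeneralLinearGroup.det g : ℝˣ) : ℂ)) *
    lowWeight (s₁ - s₂) n (entries g) * key

/-! ### Smoothness and the action of the Lie algebra -/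

/-- A local formula for `weightFun` in which the character of the determinant is explicit. -/
noncomputable def localWeight (u s : ℂ) (n : ℤ) (M : Mat) : ℂ :=
  Complex.exp (u * Real.log (M 0 0 * M 1 1 - M 0 1 * M 1 0)) * lowWeight s n M

theorem det_entries (g : G) : ((Matrix.GeneralLinearGroup.det g : ℝˣ) : ℝ) =
    entries g 0 0 * entries g 1 1 - entries g 0 1 * entries g 1 0 :=
  Matrix.det_fin_two g.val

/-- Near every point, `weightFun` is a constant multiple of the local formula, with a constant
independent of the weight. -/
theorem exists_extend_weightFun_eventuallyEq {χ : RChar} {s₁ : ℂ} (h : HasExponent χ s₁) (g : G) :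
    ∃ κ : ℂ, ∀ (s : ℂ) (n : ℤ), extend (weightFun χ s n) =ᶠ[nhds (entries g)]
      fun M => κ * localWeight (s₁ + 1 / 2) s n M := by
  have hcont : Continuous fun M : Mat => M 0 0 * M 1 1 - M 0 1 * M 1 0 := by fun_prop
  have hne := (Matrix.GeneralLinearGroup.det g).ne_zero
  have hexp : ∀ y : ℝ, Complex.exp (s₁ * y) * Complex.exp (1 / 2 * y) =
      Complex.exp ((s₁ + 1 / 2) * y) := fun y => by
    rw [← Complex.exp_add]
    ring_nf
  rcases lt_or_gt_of_ne hne with hd | hd <;> rw [det_entries] at hd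
  -- The constant is the value of the character at the sign of the determinant, which is locally
  -- constant.
  · refine ⟨χ (-1), fun s n => ?_⟩
    filter_upwards [isOpen_invertibles.mem_nhds (entries_mem g),
      hcont.continuousAt.eventually_lt continuousAt_const hd] with M hM hMd
    obtain ⟨g', rfl⟩ := exists_entries hM
    rw [extend_entries, weightFun, localWeight, h.neg (by rwa [det_entries]), det_entries, ← hexp]
    ring
  · refine ⟨1, fun s n => ?_⟩
    filter_upwards [isOpen_invertibles.mem_nhds (entries_mem g),
      continuousAt_const.eventually_lt hcont.continuousAt hd] with M hM hMd
    obtain ⟨g', rfl⟩ := exists_entries hM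
    rw [extend_entries, weightFun, localWeight, h _ (by rwa [det_entries]), det_entries, ← hexp]
    ring

theorem contDiffAt_localWeight (u s : ℂ) (n : ℤ) (g : G) :
    ContDiffAt ℝ ∞ (localWeight u s n) (entries g) := by
  have hof : ContDiff ℝ ∞ (fun x : ℝ => (x : ℂ)) := Complex.ofRealCLM.contDiff
  have hdet : entries g 0 0 * entries g 1 1 - entries g 0 1 * entries g 1 0 ≠ 0 := by
    rw [← det_entries]
    exact Units.ne_zero _
  have hlog1 : ContDiffAt ℝ ∞ (fun M : Mat => Real.log (M 0 0 * M 1 1 - M 0 1 * M 1 0))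
      (entries g) := ContDiffAt.log (by fun_prop) hdet
  have hlog2 : ContDiffAt ℝ ∞ (fun M : Mat => Real.log (lowSq M)) (entries g) := by
    refine ContDiffAt.log ?_ (lowSq_pos g).ne'
    unfold lowSq
    fun_prop
  have hlow : ContDiffAt ℝ ∞ low (entries g) := by
    have h1 : ∀ i j, ContDiffAt ℝ ∞ (fun M : Mat => (M i j : ℂ)) (entries g) := fun i j =>
      hof.contDiffAt.comp (entries g) (by fun_prop)
    exact (h1 1 1).sub (contDiffAt_const.mul (h1 1 0))
  have hpow : ContDiffAt ℝ ∞ (fun M => low M ^ n) (entries g) := by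
    cases n with
    | ofNat k => simpa using hlow.pow k
    | negSucc k =>
      simp only [zpow_negSucc]
      exact (hlow.pow (k + 1)).inv (pow_ne_zero _ (low_ne_zero g))
  have he1 : ContDiffAt ℝ ∞ (fun M : Mat =>
      Complex.exp (u * Real.log (M 0 0 * M 1 1 - M 0 1 * M 1 0))) (entries g) :=
    (contDiffAt_const.mul (hof.contDiffAt.comp (entries g) hlog1)).cexp
  have he2 : ContDiffAt ℝ ∞ (fun M : Mat =>
      Complex.exp (-((s + 1 + n) / 2) * Real.log (lowSq M))) (entries g) :=
    (contDiffAt_const.mul (hof.contDiffAt.comp (entries g) hlog2)).cexp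
  exact he1.mul (he2.mul hpow)

theorem smooth_weightFun {χ : RChar} {s₁ : ℂ} (h : HasExponent χ s₁) (s : ℂ) (n : ℤ) :
    Smooth (weightFun χ s n) := by
  intro M hM
  obtain ⟨g, rfl⟩ := exists_entries hM
  obtain ⟨κ, hκ⟩ := exists_extend_weightFun_eventuallyEq h g
  exact ((contDiffAt_const.mul (contDiffAt_localWeight (s₁ + 1 / 2) s n g)).congr_of_eventuallyEq
    (hκ s n)).contDiffWithinAt

/-- A logarithmic derivative along the line `M + t V`. That of `|w| ^ 2` is `low V / low M` plus its
conjugate, taken `-(s + 1 + n) / 2` times; that of `w ^ n` adds `n` times the first term only. -/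
theorem fderiv_localWeight (u s : ℂ) (n : ℤ) (g : G) (V : Mat) :
    fderiv ℝ (localWeight u s n) (entries g) V = localWeight u s n (entries g) *
      (u * ((V 0 0 * entries g 1 1 + entries g 0 0 * V 1 1 - V 0 1 * entries g 1 0 -
          entries g 0 1 * V 1 0 : ℝ) /
          (entries g 0 0 * entries g 1 1 - entries g 0 1 * entries g 1 0 : ℝ)) +
        (n - (s + 1 + n) / 2) * (low V / low (entries g)) -
        (s + 1 + n) / 2 * ((starRingEnd ℂ) (low V) / (starRingEnd ℂ) (low (entries g)))) := by
  set M := entries g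
  have hdet : M 0 0 * M 1 1 - M 0 1 * M 1 0 ≠ 0 := by
    rw [← det_entries]
    exact Units.ne_zero _
  have hw : low M ≠ 0 := low_ne_zero g
  have hw' : (starRingEnd ℂ) (low M) ≠ 0 := by simpa using hw
  have hline : HasDerivAt (fun t : ℝ => M + t • V) V 0 := by
    simpa using ((hasDerivAt_id (0 : ℝ)).smul_const V).const_add M
  have h0 : M + (0 : ℝ) • V = M := by simp
  have hd : HasDerivAt (fun t : ℝ => localWeight u s n (M + t • V))
      (fderiv ℝ (localWeight u s n) M V) 0 := by
    have h1 : HasFDerivAt (localWeight u s n) (fderiv ℝ (localWeight u s n) M) (M + (0 : ℝ) • V) := by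
      rw [h0]
      exact ((contDiffAt_localWeight u s n g).differentiableAt (by simp)).hasFDerivAt
    exact h1.comp_hasDerivAt (0 : ℝ) hline
  refine hd.unique ?_
  have hij : ∀ i j, HasDerivAt (fun t : ℝ => (M + t • V) i j) (V i j) 0 := fun i j =>
    hasDerivAt_pi.mp (hasDerivAt_pi.mp hline i) j
  have h1 : HasDerivAt (fun t : ℝ => Complex.exp (u * Real.log ((M + t • V) 0 0 * (M + t • V) 1 1 -
      (M + t • V) 0 1 * (M + t • V) 1 0))) _ 0 :=
    ((((((hij 0 0).mul (hij 1 1)).sub ((hij 0 1).mul (hij 1 0))).log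
      (by simpa using hdet)).ofReal_comp).const_mul u).cexp
  have h2 : HasDerivAt (fun t : ℝ => Complex.exp (-((s + 1 + n) / 2) *
      Real.log ((M + t • V) 1 0 ^ 2 + (M + t • V) 1 1 ^ 2))) _ 0 :=
    ((((((hij 1 0).pow 2).add ((hij 1 1).pow 2)).log
      (by simpa [lowSq] using (lowSq_pos g).ne')).ofReal_comp).const_mul _).cexp
  have h3 : HasDerivAt (fun t : ℝ => low (M + t • V)) (low V) 0 :=
    (hij 1 1).ofReal_comp.sub ((hij 1 0).ofReal_comp.const_mul Complex.I)
  have h4 : HasDerivAt (fun t : ℝ => low (M + t • V) ^ n) (n * low M ^ (n - 1) * low V) 0 := by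
    have := (hasDerivAt_zpow n (low (M + (0 : ℝ) • V)) (Or.inl (by rwa [h0]))).comp (0 : ℝ) h3
    rw [h0] at this
    exact this
  have hlog : ((2 * M 1 0 * V 1 0 + 2 * M 1 1 * V 1 1 : ℝ) : ℂ) / (M 1 0 ^ 2 + M 1 1 ^ 2 : ℝ) =
      low V / low M + (starRingEnd ℂ) (low V) / (starRingEnd ℂ) (low M) := by
    have e := low_mul_conj M
    rw [lowSq] at e
    rw [← e, div_add_div _ _ hw hw']
    congr 1
    simp only [low, map_sub, map_mul, Complex.conj_I, Complex.conj_ofReal]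
    push_cast
    linear_combination (2 * (M 1 0 : ℂ) * V 1 0) * Complex.I_sq
  refine (h1.mul (h2.mul h4)).congr_deriv ?_
  simp only [Pi.mul_apply, Pi.sub_apply, Pi.add_apply, Pi.pow_apply, Pi.smul_apply, zero_smul,
    Pi.zero_apply,    add_zero, smul_eq_mul, zero_mul, Nat.cast_ofNat, Nat.add_one_sub_one, pow_one]
  rw [localWeight, lowWeight, lowSq, zpow_sub_one₀ hw, Complex.ofReal_div, Complex.ofReal_div, hlog,
    ← sub_sub]
  ring

/-- The conformal part of a matrix acting on the plane. -/
noncomputable def conformalPart (X : Matrix (Fin 2) (Fin 2) ℝ) : ℂ :=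
  (X 0 0 + X 1 1 + Complex.I * (X 0 1 - X 1 0)) / 2

/-- The anticonformal part of a matrix acting on the plane. -/
noncomputable def anticonformalPart (X : Matrix (Fin 2) (Fin 2) ℝ) : ℂ :=
  (X 1 1 - X 0 0 - Complex.I * (X 0 1 + X 1 0)) / 2

/-- Every real-linear map of the complex plane has the form `w ↦ α w + β conj w`. Dividing by `w`,
the part `α` preserves weights and the part `β` shifts them. -/
theorem low_mul_matrix (g : G) (X : Matrix (Fin 2) (Fin 2) ℝ) :
    low (Matrix.of.symm (g.val * X)) = conformalPart X * low (entries g) +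
      anticonformalPart X * (starRingEnd ℂ) (low (entries g)) := by
  have h : ∀ i j, Matrix.of.symm (g.val * X) i j = entries g i 0 * X 0 j + entries g i 1 * X 1 j := by
    intro i j
    change (g.val * X) i j = _
    rw [Matrix.mul_apply, Fin.sum_univ_two]
    rfl
  simp only [low, h, conformalPart, anticonformalPart, map_sub, map_mul, Complex.conj_I,
    Complex.conj_ofReal]
  push_cast
  linear_combination ((entries g 1 0 : ℂ) * X 0 1) * Complex.I_sq

/-- The action of the Lie algebra on the weight functions. -/
theorem lieAct_weightFun {χ : RChar} {s₁ : ℂ} (h : HasExponent χ s₁) (s : ℂ) (n : ℤ)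
    (X : Matrix (Fin 2) (Fin 2) ℝ) :
    lieAct X (weightFun χ s n) =
      ((s₁ + 1 / 2) * (X 0 0 + X 1 1) - (s + 1 - n) / 2 * conformalPart X -
        (s + 1 + n) / 2 * (starRingEnd ℂ) (conformalPart X)) • weightFun χ s n -
      ((s + 1 - n) / 2 * anticonformalPart X) • weightFun χ s (n - 2) -
      ((s + 1 + n) / 2 * (starRingEnd ℂ) (anticonformalPart X)) • weightFun χ s (n + 2) := by
  funext g
  obtain ⟨κ, hκ⟩ := exists_extend_weightFun_eventuallyEq h g
  have hval : ∀ m, weightFun χ s m g = κ * localWeight (s₁ + 1 / 2) s m (entries g) := fun m => by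
    rw [← extend_entries (weightFun χ s m), (hκ s m).eq_of_nhds]
  have hw : low (entries g) ≠ 0 := low_ne_zero g
  have hw' : (starRingEnd ℂ) (low (entries g)) ≠ 0 := by simpa using hw
  have hdet : entries g 0 0 * entries g 1 1 - entries g 0 1 * entries g 1 0 ≠ 0 := by
    rw [← det_entries]
    exact Units.ne_zero _
  simp only [Pi.sub_apply, Pi.smul_apply, smul_eq_mul, hval]
  rw [lieAct, (hκ s n).fderiv_eq, fderiv_const_mul
    ((contDiffAt_localWeight (s₁ + 1 / 2) s n g).differentiableAt (by simp))]
  change κ * fderiv ℝ (localWeight (s₁ + 1 / 2) s n) (entries g) _ = _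
  rw [fderiv_localWeight, low_mul_matrix]
  have hV : ∀ i j, Matrix.of.symm (g.val * X) i j =
      entries g i 0 * X 0 j + entries g i 1 * X 1 j := by
    intro i j
    change (g.val * X) i j = _
    rw [Matrix.mul_apply, Fin.sum_univ_two]
    rfl
  -- The logarithmic derivative of the determinant in the direction `g X` is the trace of `X`.
  have htr : ((Matrix.of.symm (g.val * X) 0 0 * entries g 1 1 + entries g 0 0 *
      Matrix.of.symm (g.val * X) 1 1 - Matrix.of.symm (g.val * X) 0 1 * entries g 1 0 -
      entries g 0 1 * Matrix.of.symm (g.val * X) 1 0 : ℝ) : ℂ) /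
      (entries g 0 0 * entries g 1 1 - entries g 0 1 * entries g 1 0 : ℝ) = X 0 0 + X 1 1 := by
    rw [div_eq_iff (by exact_mod_cast hdet), ← Complex.ofReal_add, ← Complex.ofReal_mul,
      Complex.ofReal_inj]
    simp only [hV]
    ring
  rw [htr]
  simp only [localWeight, lowWeight_add_two _ _ hw, lowWeight_sub_two _ _ hw, map_add, map_mul,
    Complex.conj_conj]
  field_simp
  ring

/-! ### The orthogonal group and the Iwasawa decomposition -/

theorem rot_add (θ η : ℝ) : rot (θ + η) = rot θ * rot η := by
  ext i j
  change !![Real.cos (θ + η), Real.sin (θ + η); -Real.sin (θ + η), Real.cos (θ + η)] i j =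
    (!![Real.cos θ, Real.sin θ; -Real.sin θ, Real.cos θ] *
      !![Real.cos η, Real.sin η; -Real.sin η, Real.cos η]) i j
  fin_cases i <;> fin_cases j <;> simp [Real.cos_add, Real.sin_add] <;> ring

theorem rot_zero : rot 0 = 1 := by
  ext i j
  change !![Real.cos 0, Real.sin 0; -Real.sin 0, Real.cos 0] i j = (1 : Matrix _ _ ℝ) i j
  fin_cases i <;> fin_cases j <;> simp

theorem rot_mem_K (θ : ℝ) : rot θ ∈ K := by
  change !![Real.cos θ, Real.sin θ; -Real.sin θ, Real.cos θ] ∈ Matrix.orthogonalGroup (Fin 2) ℝ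
  rw [Matrix.mem_orthogonalGroup_iff]
  have h := Real.cos_sq_add_sin_sq θ
  ext i j
  fin_cases i <;> fin_cases j <;> simp [Matrix.mul_apply, Fin.sum_univ_two] <;> linarith

theorem refl_mem_K : refl ∈ K := by
  change !![(-1 : ℝ), 0; 0, 1] ∈ Matrix.orthogonalGroup (Fin 2) ℝ
  rw [Matrix.mem_orthogonalGroup_iff]
  ext i j
  fin_cases i <;> fin_cases j <;> simp [Matrix.mul_apply, Fin.sum_univ_two]

/-- The orthogonal group is generated by rotations and one reflection. -/
theorem eq_rot_or_eq_refl_mul_rot {k : G} (hk : k ∈ K) :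
    ∃ θ, k = rot θ ∨ k = refl * rot θ := by
  have h1 : k.val * k.val.transpose = 1 := (Matrix.mem_orthogonalGroup_iff (Fin 2) ℝ).mp hk
  have h00 := congrFun (congrFun h1 0) 0
  have h01 := congrFun (congrFun h1 0) 1
  have h11 := congrFun (congrFun h1 1) 1
  simp only [Matrix.mul_apply, Fin.sum_univ_two, Matrix.transpose_apply, Matrix.one_apply_eq] at h00 h01 h11
  rw [Matrix.one_apply_ne (by decide)] at h01
  -- An orthogonal matrix is determined by its bottom row, a unit vector giving the angle, and its
  -- determinant `e = ±1`.
  obtain ⟨θ, hc, hs⟩ : ∃ θ, Real.cos θ = k.val 1 1 ∧ Real.sin θ = -k.val 1 0 := by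
    set z : ℂ := ⟨k.val 1 1, -k.val 1 0⟩
    have hz : ‖z‖ = 1 := by
      rw [Complex.norm_def, Complex.normSq_mk]
      rw [show k.val 1 1 * k.val 1 1 + -k.val 1 0 * -k.val 1 0 = 1 by linarith, Real.sqrt_one]
    have hz0 : z ≠ 0 := norm_ne_zero_iff.mp (by rw [hz]; exact one_ne_zero)
    exact ⟨z.arg, by rw [Complex.cos_arg hz0, hz, div_one], by rw [Complex.sin_arg, hz, div_one]⟩
  set e : ℝ := k.val 0 0 * k.val 1 1 - k.val 0 1 * k.val 1 0 with he
  have e0 : k.val 0 0 = e * k.val 1 1 := by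
    rw [he]
    linear_combination (-k.val 0 0) * h11 + k.val 1 0 * h01
  have e1 : k.val 0 1 = -(e * k.val 1 0) := by
    rw [he]
    linear_combination (-k.val 0 1) * h11 + k.val 1 1 * h01
  have esq : e * e = 1 := by
    rw [e0, e1] at h00
    linear_combination h00 - e * e * h11
  have hrot : (rot θ).val = !![Real.cos θ, Real.sin θ; -Real.sin θ, Real.cos θ] := rfl
  have hrefl : refl.val = !![(-1 : ℝ), 0; 0, 1] := rfl
  refine ⟨θ, (mul_self_eq_one_iff.mp esq).imp (fun h => ?_) fun h => ?_⟩
  · rw [h] at e0 e1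
    ext i j
    rw [hrot, hc, hs]
    fin_cases i <;> fin_cases j <;> simp [e0, e1]
  · rw [h] at e0 e1
    ext i j
    rw [Units.val_mul, hrot, hrefl, hc, hs]
    fin_cases i <;> fin_cases j <;> simp [e0, e1]

/-- The Iwasawa decomposition. -/
theorem exists_eq_upper_mul_rot (g : G) : ∃ a d x θ, g = upper a d x * rot θ := by
  -- Rotating by minus this angle makes the encoded bottom row real, which kills the lower left
  -- entry.
  set θ := (low (entries g)).arg
  set b := g * rot (-θ) with hb
  have hlow : low (entries b) = (‖low (entries g)‖ : ℂ) := by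
    have h := Complex.norm_mul_exp_arg_mul_I (low (entries g))
    calc low (entries b) = Complex.exp (Complex.I * ((-θ : ℝ) : ℂ)) *
          (‖low (entries g)‖ * Complex.exp (θ * Complex.I)) := by rw [h, hb, low_mul_rot]
      _ = _ := by
        rw [mul_left_comm, ← Complex.exp_add]
        push_cast
        rw [mul_comm Complex.I, ← add_mul, neg_add_cancel, zero_mul, Complex.exp_zero, mul_one]
  have h10 : entries b 1 0 = 0 := by
    have := congrArg Complex.im hlow
    simpa [low] using this
  have hdet := (Matrix.GeneralLinearGroup.det b).ne_zero
  rw [det_entries, h10, mul_zero, sub_zero] at hdet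
  refine ⟨Units.mk0 _ (left_ne_zero_of_mul hdet), Units.mk0 _ (right_ne_zero_of_mul hdet),
    entries b 0 1, θ, ?_⟩
  have hbu : upper (Units.mk0 _ (left_ne_zero_of_mul hdet))
      (Units.mk0 _ (right_ne_zero_of_mul hdet)) (entries b 0 1) = b := by
    apply entries_injective
    change !![entries b 0 0, entries b 0 1; 0, entries b 1 1] = entries b
    ext i j
    fin_cases i <;> fin_cases j <;> simp [h10]
  rw [hbu, hb, mul_assoc, ← rot_add, neg_add_cancel, rot_zero, mul_one]

theorem Equivariant.ext_rot {χ₁ χ₂ : RChar} {f f' : G → ℂ} (hf : Equivariant χ₁ χ₂ f)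
    (hf' : Equivariant χ₁ χ₂ f') (h : ∀ θ, f (rot θ) = f' (rot θ)) : f = f' := by
  funext g
  obtain ⟨a, d, x, θ, rfl⟩ := exists_eq_upper_mul_rot g
  rw [hf, hf', h]

theorem rightTranslate_mul (h k : G) (f : G → ℂ) :
    rightTranslate (h * k) f = rightTranslate h (rightTranslate k f) := by
  funext g
  exact congrArg f (mul_assoc g h k).symm

theorem kFinite_weightFun (χ : RChar) (s : ℂ) (n : ℤ) : KFinite (weightFun χ s n) := by
  have : FiniteDimensional ℂ (Submodule.span ℂ {weightFun χ s n, weightFun χ s (-n)}) :=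
    FiniteDimensional.span_of_finite ℂ (by simp)
  refine KFinite.of_le this fun k hk => ?_
  have h1 : weightFun χ s n ∈ Submodule.span ℂ {weightFun χ s n, weightFun χ s (-n)} :=
    Submodule.subset_span (by simp)
  have h2 : weightFun χ s (-n) ∈ Submodule.span ℂ {weightFun χ s n, weightFun χ s (-n)} :=
    Submodule.subset_span (by simp)
  obtain ⟨θ, rfl | rfl⟩ := eq_rot_or_eq_refl_mul_rot hk
  · rw [rightTranslate_rot_weightFun]
    exact Submodule.smul_mem _ _ h1
  · rw [rightTranslate_mul, rightTranslate_rot_weightFun, map_smul, rightTranslate_refl_weightFun]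
    exact Submodule.smul_mem _ _ (Submodule.smul_mem _ _ h2)

/-- The weight `n` occurs in the principal series `χ₁ × χ₂`. -/
def IsWeight (χ₁ χ₂ : RChar) (n : ℤ) : Prop := (χ₁ (-1) : ℂ) * χ₂ (-1) = (-1) ^ n

theorem weightFun_mem_principalSeries {χ₁ χ₂ : RChar} {s₁ s₂ : ℂ} (h₁ : HasExponent χ₁ s₁)
    (h₂ : HasExponent χ₂ s₂) {n : ℤ} (hn : IsWeight χ₁ χ₂ n) :
    weightFun χ₁ (s₁ - s₂) n ∈ principalSeries χ₁ χ₂ :=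
  ⟨smooth_weightFun h₁ _ n, kFinite_weightFun _ _ _, equivariant_weightFun h₁ h₂ hn⟩

/-! ### Fourier expansion along `SO(2)` -/

theorem rot_two_pi : rot (2 * Real.pi) = 1 := by
  ext i j
  change !![Real.cos (2 * Real.pi), Real.sin (2 * Real.pi);
    -Real.sin (2 * Real.pi), Real.cos (2 * Real.pi)] i j = (1 : Matrix _ _ ℝ) i j
  fin_cases i <;> fin_cases j <;> simp

theorem rot_pi : rot Real.pi = upper (-1) (-1) 0 := by
  apply entries_injective
  change !![Real.cos Real.pi, Real.sin Real.pi; -Real.sin Real.pi, Real.cos Real.pi] =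
    !![((-1 : ℝˣ) : ℝ), 0; 0, ((-1 : ℝˣ) : ℝ)]
  simp

/-- Rotation by `π` is the central matrix `-1`, hence also an upper triangular one. Comparing the
resulting scalar with `e ^ (inπ)` forces the parity of the weights. -/
theorem rightTranslate_rot_pi {χ₁ χ₂ : RChar} {f : G → ℂ} (hf : Equivariant χ₁ χ₂ f) :
    rightTranslate (rot Real.pi) f = ((χ₁ (-1) : ℂ) * χ₂ (-1)) • f := by
  funext g
  have h : g * rot Real.pi = upper (-1) (-1) 0 * g := by
    rw [rot_pi]
    have : upper (-1) (-1) 0 = (-1 : G) := by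
      ext i j
      change !![((-1 : ℝˣ) : ℝ), 0; 0, ((-1 : ℝˣ) : ℝ)] i j = (-1 : Matrix _ _ ℝ) i j
      fin_cases i <;> fin_cases j <;> simp
    rw [this]
    simp
  change f (g * rot Real.pi) = _
  rw [h, hf]
  simp

theorem periodic_rot (f : G → ℂ) : Function.Periodic (fun θ => f (rot θ)) (2 * Real.pi) := by
  intro θ
  simp only [rot_add, rot_two_pi, mul_one]

/-- The restriction to `SO(2)`, as a function on the circle. -/
noncomputable def onCircle (f : G → ℂ) : AddCircle (2 * Real.pi) → ℂ := (periodic_rot f).lift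

theorem Smooth.continuous_rot {f : G → ℂ} (hf : Smooth f) : Continuous fun θ => f (rot θ) := by
  have h : Continuous fun θ => entries (rot θ) := by
    change Continuous fun θ => (!![Real.cos θ, Real.sin θ; -Real.sin θ, Real.cos θ] : Mat)
    refine continuous_pi fun i => continuous_pi fun j => ?_
    fin_cases i <;> fin_cases j <;> simp <;> fun_prop
  have h2 := ContinuousOn.comp_continuous (ContDiffOn.continuousOn hf) h fun θ => entries_mem _
  exact h2.congr fun θ => extend_entries f (rot θ)

theorem Smooth.continuous_onCircle {f : G → ℂ} (hf : Smooth f) : Continuous (onCircle f) :=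
  continuous_coinduced_dom.mpr hf.continuous_rot

/-- Irrationality of `π` lets a single operator, rotation by one radian, separate all weights. -/
theorem exp_I_mul_int_injective :
    Function.Injective fun n : ℤ => Complex.exp (Complex.I * (n * (1 : ℝ))) := by
  intro m n h
  obtain ⟨k, hk⟩ := Complex.exp_eq_exp_iff_exists_int.mp h
  have h1 : ((m - n - 2 * k * Real.pi : ℝ) : ℂ) = 0 := by
    push_cast
    have := mul_left_cancel₀ Complex.I_ne_zero
      (show Complex.I * (m * (1 : ℝ)) = Complex.I * (n * (1 : ℝ) + k * (2 * Real.pi)) by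
        rw [hk]; ring)
    push_cast at this
    linear_combination this
  have h2 : (m : ℝ) - n = (2 * k : ℤ) * Real.pi := by
    push_cast
    linarith [Complex.ofReal_eq_zero.mp h1]
  by_contra hmn
  have hk0 : (2 * k : ℤ) ≠ 0 := by
    intro h0
    rw [h0] at h2
    exact hmn (by exact_mod_cast (by linarith [h2, show ((0 : ℤ) : ℝ) * Real.pi = 0 by simp] : (m : ℝ) = n))
  refine (irrational_pi.intCast_mul hk0).ne_int (m - n) ?_
  rw [← h2]
  push_cast
  rfl

/-- Applying `T - μ a` removes the term of index `a` and rescales the others by nonzero factors, so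
induction on the number of terms applies. -/
theorem mem_of_sum_mem_of_eigenvectors {M ι : Type*} [AddCommGroup M] [Module ℂ M]
    {T : Module.End ℂ M} {W : Submodule ℂ M} (hW : ∀ x ∈ W, T x ∈ W) {μ : ι → ℂ}
    (hμ : Function.Injective μ) (s : Finset ι) : ∀ v : ι → M, (∀ i ∈ s, T (v i) = μ i • v i) →
      ∑ i ∈ s, v i ∈ W → ∀ i ∈ s, v i ∈ W := by
  classical
  induction s using Finset.induction_on with
  | empty => simp
  | insert a s ha ih =>
    intro v hv hsum
    have h1 : ∑ i ∈ s, (μ i - μ a) • v i ∈ W := by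
      have h2 := W.sub_mem (hW _ hsum) (W.smul_mem (μ a) hsum)
      rw [map_sum, Finset.smul_sum, ← Finset.sum_sub_distrib, Finset.sum_insert ha,
        hv a (Finset.mem_insert_self a s), sub_self, zero_add] at h2
      convert! h2 using 1
      refine Finset.sum_congr rfl fun i hi => ?_
      rw [hv i (Finset.mem_insert_of_mem hi), sub_smul]
    have h2 : ∀ i ∈ s, v i ∈ W := by
      intro i hi
      have h3 := ih (fun i => (μ i - μ a) • v i) (fun i hi => by
        rw [map_smul, hv i (Finset.mem_insert_of_mem hi), smul_comm]) h1 i hi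
      have h4 : μ i - μ a ≠ 0 := sub_ne_zero.mpr fun h => ha (hμ h ▸ hi)
      exact (W.smul_mem_iff h4).mp h3
    intro i hi
    rcases Finset.mem_insert.mp hi with rfl | hi
    · rw [Finset.sum_insert ha] at hsum
      exact (W.add_mem_iff_left (W.sum_mem h2)).mp hsum
    · exact h2 i hi

instance fact_two_pi_pos : Fact (0 < 2 * Real.pi) := ⟨Real.two_pi_pos⟩

/-- The Fourier coefficients of the restriction to `SO(2)`. -/
noncomputable def weightCoeff (n : ℤ) : smoothSubmodule →ₗ[ℂ] ℂ where
  toFun f := fourierCoeff (onCircle f.1) n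
  map_add' f f' := by
    have h1 : onCircle (f + f').1 = onCircle f.1 + onCircle f'.1 := by
      funext x
      induction x using QuotientAddGroup.induction_on
      rfl
    have hi : ∀ f : smoothSubmodule, MeasureTheory.Integrable (onCircle f.1) AddCircle.haarAddCircle :=
      fun f => (Smooth.continuous_onCircle f.2).integrable_of_hasCompactSupport
        (HasCompactSupport.of_compactSpace _)
    rw [h1, fourierCoeff.add (hi f) (hi f')]
    rfl
  map_smul' c f := by
    have h1 : onCircle (c • f).1 = c • onCircle f.1 := by
      funext x
      induction x using QuotientAddGroup.induction_on
      rfl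
    rw [h1, fourierCoeff.const_smul]
    rfl

/-- Translation invariance of Haar measure. In dual form, taking the coefficient of index `n` is an
eigenvector of the transpose of rotation. -/
theorem fourierCoeff_onCircle_rot (f : G → ℂ) (η : ℝ) (n : ℤ) :
    fourierCoeff (onCircle (rightTranslate (rot η) f)) n =
      Complex.exp (Complex.I * (n * η)) * fourierCoeff (onCircle f) n := by
  have h1 : ∀ x : AddCircle (2 * Real.pi),
      onCircle (rightTranslate (rot η) f) x = onCircle f (x + (η : AddCircle (2 * Real.pi))) := by
    intro x
    induction x using QuotientAddGroup.induction_on with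
    | H θ =>
      change f (rot θ * rot η) = f (rot (θ + η))
      rw [rot_add]
  have h2 : ∀ x : AddCircle (2 * Real.pi), fourier (-n) x =
      Complex.exp (Complex.I * (n * η)) * fourier (-n) (x + (η : AddCircle (2 * Real.pi))) := by
    intro x
    have h3 : fourier (-n) (x + (η : AddCircle (2 * Real.pi))) =
        fourier (-n) x * fourier (-n) (η : AddCircle (2 * Real.pi)) := by
      simp only [fourier_apply, smul_add, AddCircle.toCircle_add, Circle.coe_mul]
    rw [h3, fourier_coe_apply, mul_left_comm, ← Complex.exp_add]
    have h4 : Complex.I * (n * η) + 2 * Real.pi * Complex.I * ((-n : ℤ) : ℂ) * η /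
        ((2 * Real.pi : ℝ) : ℂ) = 0 := by
      have : (Real.pi : ℂ) ≠ 0 := Complex.ofReal_ne_zero.mpr Real.pi_ne_zero
      push_cast
      field_simp
      ring
    rw [h4, Complex.exp_zero, mul_one]
  simp only [fourierCoeff, smul_eq_mul]
  rw [← MeasureTheory.integral_const_mul, ← MeasureTheory.integral_add_right_eq_self
    (fun x => Complex.exp (Complex.I * (n * η)) * (fourier (-n) x * onCircle f x))
    (η : AddCircle (2 * Real.pi))]
  refine MeasureTheory.integral_congr_ae (Filter.Eventually.of_forall fun x => ?_)
  beta_reduce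
  rw [h1, h2 x]
  ring

theorem kSpan_le_smoothSubmodule {f : G → ℂ} (hf : Smooth f) : kSpan f ≤ smoothSubmodule := by
  rw [kSpan, Submodule.span_le]
  rintro _ ⟨k, -, rfl⟩
  exact hf.rightTranslate k

theorem rightTranslate_mem_kSpan_of_mem {f h : G → ℂ} {k : G} (hk : k ∈ K) (hh : h ∈ kSpan f) :
    rightTranslate k h ∈ kSpan f := by
  have hle : kSpan f ≤ (kSpan f).comap (rightTranslate k) := by
    conv_lhs => rw [kSpan]
    rw [Submodule.span_le]
    rintro _ ⟨l, hl, rfl⟩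
    change rightTranslate k (rightTranslate l f) ∈ kSpan f
    rw [← rightTranslate_mul]
    exact rightTranslate_mem_kSpan f ((Matrix.orthogonalGroup (Fin 2) ℝ).mul_mem hk hl)
  exact hle hh

theorem mem_kSpan_self (f : G → ℂ) : f ∈ kSpan f := by
  have h := rightTranslate_mem_kSpan f (k := 1) (Matrix.orthogonalGroup (Fin 2) ℝ).one_mem
  convert! h using 1
  funext g
  exact congrArg f (mul_one g).symm

/-- The restriction to `SO(2)` of an `O(2)`-finite function has finitely many nonzero Fourier
coefficients, because these are eigenvectors for distinct eigenvalues in a finite-dimensional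
dual space. -/
theorem finite_fourierCoeff_ne_zero {f : G → ℂ} (hs : Smooth f) (hf : KFinite f) :
    {n : ℤ | fourierCoeff (onCircle f) n ≠ 0}.Finite := by
  have hfin : FiniteDimensional ℂ (kSpan f) := hf
  have hle := kSpan_le_smoothSubmodule hs
  let T : Module.End ℂ (kSpan f) := (rightTranslate (rot 1)).restrict
    fun h hh => rightTranslate_mem_kSpan_of_mem (rot_mem_K 1) hh
  let l : ℤ → Module.Dual ℂ (kSpan f) := fun n => weightCoeff n ∘ₗ Submodule.inclusion hle
  have hl : ∀ n h, l n h = fourierCoeff (onCircle h.1) n := fun _ _ => rfl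
  have hli := Module.End.eigenvectors_linearIndependent' (R := ℂ) (M := Module.Dual ℂ (kSpan f))
    T.dualMap (fun n : {n : ℤ | fourierCoeff (onCircle f) n ≠ 0} =>
      Complex.exp (Complex.I * (n.1 * (1 : ℝ)))) (exp_I_mul_int_injective.comp Subtype.val_injective)
    (fun n => l n.1) (fun n => by
      refine ⟨Module.End.mem_eigenspace_iff.mpr ?_, fun h0 => n.2 ?_⟩
      · ext h
        exact fourierCoeff_onCircle_rot h.1 1 n.1
      · exact DFunLike.congr_fun h0 (⟨f, mem_kSpan_self f⟩ : kSpan f))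
  exact hli.finite

theorem exp_I_mul_int_mul_pi (n : ℤ) : Complex.exp (Complex.I * (n * Real.pi)) = (-1) ^ n := by
  rw [show Complex.I * (n * Real.pi) = n * (Real.pi * Complex.I) by ring, Complex.exp_int_mul,
    Complex.exp_pi_mul_I]

theorem isWeight_of_fourierCoeff_ne_zero {χ₁ χ₂ : RChar} {f : G → ℂ} (hf : Equivariant χ₁ χ₂ f)
    {n : ℤ} (hn : fourierCoeff (onCircle f) n ≠ 0) : IsWeight χ₁ χ₂ n := by
  have h := fourierCoeff_onCircle_rot f Real.pi n
  have h1 : onCircle (((χ₁ (-1) : ℂ) * χ₂ (-1)) • f) = ((χ₁ (-1) : ℂ) * χ₂ (-1)) • onCircle f := by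
    funext x
    induction x using QuotientAddGroup.induction_on
    rfl
  rw [rightTranslate_rot_pi hf, h1, fourierCoeff.const_smul, exp_I_mul_int_mul_pi] at h
  exact mul_right_cancel₀ hn h

/-- Elements of the principal series are finite linear combinations of weight functions. -/
theorem exists_eq_sum_weightFun {χ₁ χ₂ : RChar} {s₁ s₂ : ℂ} (h₁ : HasExponent χ₁ s₁)
    (h₂ : HasExponent χ₂ s₂) {f : G → ℂ} (hf : f ∈ principalSeries χ₁ χ₂) :
    ∃ (N : Finset ℤ) (c : ℤ → ℂ), (∀ n ∈ N, c n ≠ 0 ∧ IsWeight χ₁ χ₂ n) ∧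
      f = ∑ n ∈ N, c n • weightFun χ₁ (s₁ - s₂) n := by
  obtain ⟨hs, hk, he⟩ := hf
  have hfin := finite_fourierCoeff_ne_zero hs hk
  have hN : ∀ n ∈ hfin.toFinset, fourierCoeff (onCircle f) n ≠ 0 ∧ IsWeight χ₁ χ₂ n := by
    intro n hn
    have hn' : fourierCoeff (onCircle f) n ≠ 0 := by simpa using hn
    exact ⟨hn', isWeight_of_fourierCoeff_ne_zero he hn'⟩
  refine ⟨hfin.toFinset, fourierCoeff (onCircle f), hN, he.ext_rot ?_ fun θ => ?_⟩
  · exact (Submodule.sum_mem (principalSeries χ₁ χ₂) fun n hn => Submodule.smul_mem _ _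
      (weightFun_mem_principalSeries h₁ h₂ (hN n hn).2)).2.2
  · let F : C(AddCircle (2 * Real.pi), ℂ) := ⟨onCircle f, hs.continuous_onCircle⟩
    -- Finite support makes the Fourier series summable, so it converges pointwise to the continuous
    -- function without any decay estimate.
    have hsum : Summable (fourierCoeff F) := summable_of_hasFiniteSupport hfin
    have h := has_pointwise_sum_fourier_series_of_summable hsum (θ : AddCircle (2 * Real.pi))
    have h' := hasSum_sum_of_ne_finset_zero (L := .unconditional ℤ)
      (f := fun n => fourierCoeff F n • fourier n (θ : AddCircle (2 * Real.pi)))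
      (s := hfin.toFinset) fun n hn => by
        have h0 : fourierCoeff (onCircle f) n = 0 := by simpa using hn
        exact (congrArg (· • _) h0).trans (zero_smul ℂ _)
    change F (θ : AddCircle (2 * Real.pi)) = _
    rw [h.unique h', Finset.sum_apply]
    refine Finset.sum_congr rfl fun n _ => ?_
    rw [Pi.smul_apply, weightFun_rot, fourier_coe_apply]
    have : (Real.pi : ℂ) ≠ 0 := Complex.ofReal_ne_zero.mpr Real.pi_ne_zero
    congr 2
    push_cast
    field_simp

/-! ### Stable subspaces and the ladder of weights -/

/-- The two matrices have no conformal part, and their anticonformal parts are `1` and `-i`. In the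
complex combination below the lowering terms cancel and the raising terms add up. -/
theorem IsStable.weightFun_add_two_mem {W : Submodule ℂ (G → ℂ)} (hW : IsStable W) {χ : RChar}
    {s₁ s : ℂ} (h : HasExponent χ s₁) {n : ℤ} (hn : s + 1 + n ≠ 0) (hf : weightFun χ s n ∈ W) :
    weightFun χ s (n + 2) ∈ W := by
  have h1 := W.sub_mem (hW.1 !![-1, 0; 0, 1] _ hf)
    (W.smul_mem Complex.I (hW.1 !![0, 1; 1, 0] _ hf))
  have h2 : lieAct !![-1, 0; 0, 1] (weightFun χ s n) -
      Complex.I • lieAct !![0, 1; 1, 0] (weightFun χ s n) =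
      (-(s + 1 + n)) • weightFun χ s (n + 2) := by
    rw [lieAct_weightFun h, lieAct_weightFun h]
    funext g
    have hconj : (starRingEnd ℂ) 2 = 2 := map_ofNat _ 2
    simp [conformalPart, anticonformalPart, hconj]
    linear_combination ((s + 1 + n) * weightFun χ s (n + 2) g / 2 -
      (s + 1 - n) * weightFun χ s (n - 2) g / 2) * Complex.I_sq
  rw [h2] at h1
  exact (W.smul_mem_iff (neg_ne_zero.mpr hn)).mp h1

theorem IsStable.weightFun_neg_mem {W : Submodule ℂ (G → ℂ)} (hW : IsStable W) {χ : RChar}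
    {s : ℂ} {n : ℤ} (hf : weightFun χ s n ∈ W) : weightFun χ s (-n) ∈ W := by
  have h := hW.2 refl refl_mem_K _ hf
  rw [rightTranslate_refl_weightFun] at h
  exact (W.smul_mem_iff (Units.ne_zero _)).mp h

theorem weightFun_ne_zero (χ : RChar) (s : ℂ) (n : ℤ) : weightFun χ s n ≠ 0 := by
  intro h
  have h1 := weightFun_rot χ s n 0
  rw [h] at h1
  exact Complex.exp_ne_zero _ h1.symm

theorem linearIndependent_weightFun (χ : RChar) (s : ℂ) :
    LinearIndependent ℂ (weightFun χ s) :=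
  Module.End.eigenvectors_linearIndependent' (rightTranslate (rot 1)) _ exp_I_mul_int_injective _
    fun n => ⟨Module.End.mem_eigenspace_iff.mpr (rightTranslate_rot_weightFun χ s n 1),
      weightFun_ne_zero χ s n⟩

theorem isWeight_iff_even_sub {χ₁ χ₂ : RChar} {m n : ℤ} (hm : IsWeight χ₁ χ₂ m) :
    IsWeight χ₁ χ₂ n ↔ Even (m - n) := by
  have h1 : ((-1 : ℂ)) ^ n ≠ 0 := zpow_ne_zero _ (by norm_num)
  rw [IsWeight, hm, ← div_eq_one_iff_eq h1, ← zpow_sub₀ (by norm_num)]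
  refine ⟨fun h => ?_, fun h => h.neg_one_zpow⟩
  by_contra hodd
  rw [Int.not_even_iff_odd] at hodd
  rw [hodd.neg_one_zpow] at h
  norm_num at h

theorem exists_isWeight (χ₁ χ₂ : RChar) : ∃ n, IsWeight χ₁ χ₂ n := by
  unfold IsWeight
  rcases χ₁.neg_one_eq with h | h <;> rcases χ₂.neg_one_eq with h' | h' <;> rw [h, h']
  exacts [⟨0, by simp⟩, ⟨1, by simp⟩, ⟨1, by simp⟩, ⟨0, by simp⟩]

/-- A nonzero stable subspace of the principal series contains a weight function. -/
theorem exists_weightFun_mem {χ₁ χ₂ : RChar} {s₁ s₂ : ℂ} (h₁ : HasExponent χ₁ s₁)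
    (h₂ : HasExponent χ₂ s₂) {W : Submodule ℂ (G → ℂ)} (hle : W ≤ principalSeries χ₁ χ₂)
    (hW : IsStable W) (hne : W ≠ ⊥) :
    ∃ n, IsWeight χ₁ χ₂ n ∧ weightFun χ₁ (s₁ - s₂) n ∈ W := by
  obtain ⟨f, hf, hf0⟩ := W.ne_bot_iff.mp hne
  obtain ⟨N, c, hN, hsum⟩ := exists_eq_sum_weightFun h₁ h₂ (hle hf)
  obtain ⟨n, hn⟩ : N.Nonempty := by
    rw [Finset.nonempty_iff_ne_empty]
    rintro rfl
    exact hf0 (by simpa using hsum)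
  refine ⟨n, (hN n hn).2, (W.smul_mem_iff (hN n hn).1).mp ?_⟩
  refine mem_of_sum_mem_of_eigenvectors (T := rightTranslate (rot 1))
    (fun x hx => hW.2 _ (rot_mem_K 1) x hx) exp_I_mul_int_injective N
    (fun n => c n • weightFun χ₁ (s₁ - s₂) n) (fun i _ => ?_) (hsum ▸ hf) n hn
  rw [map_smul, rightTranslate_rot_weightFun, smul_comm]

theorem principalSeries_le {χ₁ χ₂ : RChar} {s₁ s₂ : ℂ} (h₁ : HasExponent χ₁ s₁)
    (h₂ : HasExponent χ₂ s₂) {W : Submodule ℂ (G → ℂ)}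
    (h : ∀ n, IsWeight χ₁ χ₂ n → weightFun χ₁ (s₁ - s₂) n ∈ W) : principalSeries χ₁ χ₂ ≤ W := by
  intro f hf
  obtain ⟨N, c, hN, rfl⟩ := exists_eq_sum_weightFun h₁ h₂ hf
  exact W.sum_mem fun n hn => W.smul_mem _ (h n (hN n hn).2)

/-- The principal series is irreducible if no raising operator vanishes on a weight, except
possibly from weight `-1` to weight `1`. -/
theorem isIrreducible_of_forall {χ₁ χ₂ : RChar} {s₁ s₂ : ℂ} (h₁ : HasExponent χ₁ s₁)
    (h₂ : HasExponent χ₂ s₂)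
    (h : ∀ n : ℤ, IsWeight χ₁ χ₂ n → s₁ - s₂ + 1 + n = 0 → n = -1) : IsIrreducible χ₁ χ₂ := by
  refine ⟨fun hbot => ?_, fun W hle hW => or_iff_not_imp_left.mpr fun hne =>
    hle.antisymm (principalSeries_le h₁ h₂ ?_)⟩
  · obtain ⟨n, hn⟩ := exists_isWeight χ₁ χ₂
    have hmem := weightFun_mem_principalSeries h₁ h₂ hn
    rw [hbot, Submodule.mem_bot] at hmem
    exact weightFun_ne_zero _ _ _ hmem
  obtain ⟨m, hm, hmW⟩ := exists_weightFun_mem h₁ h₂ hle hW hne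
  have hup : ∀ n : ℤ, n ≠ -1 → IsWeight χ₁ χ₂ n → weightFun χ₁ (s₁ - s₂) n ∈ W →
      weightFun χ₁ (s₁ - s₂) (n + 2) ∈ W := fun n hn1 hn hnW =>
    hW.weightFun_add_two_mem h₁ (fun h0 => hn1 (h n hn h0)) hnW
  -- Lowering from `n` is the reflection of raising from `-n`, so the excluded weight becomes `1`.
  have hdown : ∀ n : ℤ, n ≠ 1 → IsWeight χ₁ χ₂ n → weightFun χ₁ (s₁ - s₂) n ∈ W →
      weightFun χ₁ (s₁ - s₂) (n - 2) ∈ W := fun n hn1 hn hnW => by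
    have h3 := hup (-n) (by omega)
      ((isWeight_iff_even_sub hn).mpr ⟨n, by ring⟩) (hW.weightFun_neg_mem hnW)
    have h4 := hW.weightFun_neg_mem h3
    rwa [show -(-n + 2) = n - 2 by ring] at h4
  have hw : ∀ n, IsWeight χ₁ χ₂ n ↔ Even (m - n) := fun n => isWeight_iff_even_sub hm

  obtain ⟨m', hm', hm'W⟩ : ∃ m' : ℕ, IsWeight χ₁ χ₂ m' ∧
      weightFun χ₁ (s₁ - s₂) (m' : ℤ) ∈ W := by
    rcases le_total 0 m with h0 | h0
    · exact ⟨m.toNat, by rwa [Int.toNat_of_nonneg h0], by rwa [Int.toNat_of_nonneg h0]⟩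
    · refine ⟨(-m).toNat, ?_, ?_⟩ <;> rw [Int.toNat_of_nonneg (by omega)]
      · exact (hw _).mpr ⟨m, by ring⟩
      · exact hW.weightFun_neg_mem hmW
  have hU : ∀ k : ℕ, weightFun χ₁ (s₁ - s₂) ((m' : ℤ) + 2 * k) ∈ W := by
    intro k
    induction k with
    | zero => simpa using hm'W
    | succ k ih =>
      have := hup _ (by omega) ((isWeight_iff_even_sub hm').mpr ⟨-k, by ring⟩) ih
      rwa [add_assoc, show (2 * k + 2 : ℤ) = 2 * (k + 1 : ℕ) by push_cast; ring] at this
  -- The bound keeps the weights nonnegative, so no step down starts at `1`. Negative weights are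
  -- recovered by reflection.
  have hD : ∀ k : ℕ, 2 * k ≤ m' → weightFun χ₁ (s₁ - s₂) ((m' : ℤ) - 2 * k) ∈ W := by
    intro k
    induction k with
    | zero => intro _; simpa using hm'W
    | succ k ih =>
      intro hk
      have := hdown _ (by omega) ((isWeight_iff_even_sub hm').mpr ⟨k, by ring⟩) (ih (by omega))
      rwa [sub_sub, show (2 * k + 2 : ℤ) = 2 * (k + 1 : ℕ) by push_cast; ring] at this
  have hnonneg : ∀ n : ℤ, 0 ≤ n → IsWeight χ₁ χ₂ n → weightFun χ₁ (s₁ - s₂) n ∈ W := by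
    intro n h0 hn
    obtain ⟨j, hj⟩ := (isWeight_iff_even_sub hm').mp hn
    rcases le_total 0 j with hj0 | hj0
    · have := hD j.toNat (by omega)
      rwa [show (m' : ℤ) - 2 * (j.toNat : ℤ) = n by omega] at this
    · have := hU (-j).toNat
      rwa [show (m' : ℤ) + 2 * ((-j).toNat : ℤ) = n by omega] at this
  intro n hn
  rcases le_total 0 n with h0 | h0
  · exact hnonneg n h0 hn
  · have := hW.weightFun_neg_mem (hnonneg (-n) (by omega)
      ((isWeight_iff_even_sub hn).mpr ⟨n, by ring⟩))
    rwa [neg_neg] at this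

/-- A set of weights closed under the action of the Lie algebra and the reflection spans a stable
subspace. -/
theorem isStable_span_weightFun {χ : RChar} {s₁ s : ℂ} (h : HasExponent χ s₁) {J : Set ℤ}
    (hneg : ∀ n ∈ J, -n ∈ J) (hup : ∀ n ∈ J, n + 2 ∈ J ∨ s + 1 + n = 0) :
    IsStable (Submodule.span ℂ (weightFun χ s '' J)) := by
  set W := Submodule.span ℂ (weightFun χ s '' J) with hWdef
  have hmem : ∀ n ∈ J, weightFun χ s n ∈ W := fun n hn => Submodule.subset_span ⟨n, hn, rfl⟩
  have hsm : W ≤ smoothSubmodule := by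
    rw [hWdef, Submodule.span_le]
    rintro _ ⟨n, -, rfl⟩
    exact smooth_weightFun h s n
  refine ⟨fun X f hf => ?_, fun k hk f hf => ?_⟩
  -- Linearity of `lieAct X` is available on smooth functions, so the span is handled inside
  -- `smoothSubmodule`.
  · have hle : (Submodule.span ℂ (weightFun χ s '' J)) ≤
        (W.comap (lieActLinear X)).map smoothSubmodule.subtype := by
      rw [Submodule.span_le]
      rintro _ ⟨n, hn, rfl⟩
      refine ⟨⟨weightFun χ s n, smooth_weightFun h s n⟩, ?_, rfl⟩
      change lieAct X (weightFun χ s n) ∈ W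
      rw [lieAct_weightFun h]
      refine W.sub_mem (W.sub_mem (W.smul_mem _ (hmem n hn)) ?_) ?_
      -- The lowering coefficient at `n` is the raising coefficient at `-n`, so symmetry of `J`
      -- spares a hypothesis on lowering.
      · rcases hup (-n) (hneg n hn) with h1 | h1
        · refine W.smul_mem _ (hmem _ ?_)
          have := hneg _ h1
          rwa [show -(-n + 2) = n - 2 by ring] at this
        · have h2 : s + 1 - n = 0 := by
            push_cast at h1
            linear_combination h1
          simp [h2]
      · rcases hup n hn with h1 | h1
        · exact W.smul_mem _ (hmem _ h1)
        · simp [h1]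
    obtain ⟨f', hf', rfl⟩ := hle hf
    exact hf'
  · have hgen : ∀ k ∈ K, (∀ n ∈ J, rightTranslate k (weightFun χ s n) ∈ W) →
        ∀ f ∈ W, rightTranslate k f ∈ W := by
      intro k _ hk f hf
      have hle : Submodule.span ℂ (weightFun χ s '' J) ≤ W.comap (rightTranslate k) := by
        rw [Submodule.span_le]
        rintro _ ⟨n, hn, rfl⟩
        exact hk n hn
      exact hle hf
    have hrot : ∀ θ, ∀ f ∈ W, rightTranslate (rot θ) f ∈ W := fun θ =>
      hgen _ (rot_mem_K θ) fun n hn => by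
        rw [rightTranslate_rot_weightFun]
        exact W.smul_mem _ (hmem n hn)
    have hrefl : ∀ f ∈ W, rightTranslate refl f ∈ W := hgen _ refl_mem_K fun n hn => by
      rw [rightTranslate_refl_weightFun]
      exact W.smul_mem _ (hmem _ (hneg n hn))
    obtain ⟨θ, rfl | rfl⟩ := eq_rot_or_eq_refl_mul_rot hk
    · exact hrot θ f hf
    · rw [rightTranslate_mul]
      exact hrefl _ (hrot θ f hf)

theorem isReducible_of_weights {χ₁ χ₂ : RChar} {s₁ s₂ : ℂ} (h₁ : HasExponent χ₁ s₁)
    (h₂ : HasExponent χ₂ s₂) {J : Set ℤ} (hJ : ∀ n ∈ J, IsWeight χ₁ χ₂ n) (hne : J.Nonempty)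
    (hproper : ∃ m, IsWeight χ₁ χ₂ m ∧ m ∉ J) (hneg : ∀ n ∈ J, -n ∈ J)
    (hup : ∀ n ∈ J, n + 2 ∈ J ∨ s₁ - s₂ + 1 + n = 0) : IsReducible χ₁ χ₂ := by
  refine ⟨Submodule.span ℂ (weightFun χ₁ (s₁ - s₂) '' J), ?_,
    isStable_span_weightFun h₁ hneg hup, ?_, ?_⟩
  · rw [Submodule.span_le]
    rintro _ ⟨n, hn, rfl⟩
    exact weightFun_mem_principalSeries h₁ h₂ (hJ n hn)
  · obtain ⟨n, hn⟩ := hne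
    exact (Submodule.ne_bot_iff _).mpr
      ⟨_, Submodule.subset_span ⟨n, hn, rfl⟩, weightFun_ne_zero _ _ _⟩
  · obtain ⟨m, hm, hmJ⟩ := hproper
    intro heq
    refine (linearIndependent_weightFun χ₁ (s₁ - s₂)).notMem_span_image hmJ ?_
    rw [heq]
    exact weightFun_mem_principalSeries h₁ h₂ hm

/-- The principal series is reducible if a raising operator vanishes on a weight other than
`-1`. -/
theorem isReducible_of_weight {χ₁ χ₂ : RChar} {s₁ s₂ : ℂ} (h₁ : HasExponent χ₁ s₁)
    (h₂ : HasExponent χ₂ s₂) {m : ℤ} (hm : IsWeight χ₁ χ₂ m) (hs : s₁ - s₂ + 1 + m = 0)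
    (hm1 : m ≠ -1) : IsReducible χ₁ χ₂ := by
  have hw : ∀ n, IsWeight χ₁ χ₂ n ↔ Even (m - n) := fun n => isWeight_iff_even_sub hm
  rcases le_or_gt 0 m with h0 | h0
  -- The weights from `-m` to `m` span a finite-dimensional stable subspace: raising stops at `m`
  -- and lowering at `-m`.
  · refine isReducible_of_weights h₁ h₂ (J := {n | IsWeight χ₁ χ₂ n ∧ -m ≤ n ∧ n ≤ m})
      (fun n hn => hn.1) ⟨m, hm, by omega, le_rfl⟩
      ⟨m + 2, (hw _).mpr ⟨-1, by ring⟩, fun h => by have := h.2.2; omega⟩ ?_ ?_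
    · rintro n ⟨hn, h1, h2⟩
      exact ⟨(isWeight_iff_even_sub hn).mpr ⟨n, by ring⟩, by omega, by omega⟩
    · rintro n ⟨hn, h1, h2⟩
      obtain ⟨j, hj⟩ := (hw n).mp hn
      rcases eq_or_ne n m with rfl | hnm
      · exact Or.inr hs
      · exact Or.inl ⟨(hw _).mpr ⟨j - 1, by omega⟩, by omega, by omega⟩
  -- Here the two outer tails of weights are stable. They omit `m + 2` because `m ≤ -2`; for `m =
  -- -1` they would contain every weight.
  · refine isReducible_of_weights h₁ h₂ (J := {n | IsWeight χ₁ χ₂ n ∧ (n ≤ m ∨ -m ≤ n)})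
      (fun n hn => hn.1) ⟨m, hm, Or.inl le_rfl⟩
      ⟨m + 2, (hw _).mpr ⟨-1, by ring⟩, fun h => by have := h.2; omega⟩ ?_ ?_
    · rintro n ⟨hn, h1⟩
      exact ⟨(isWeight_iff_even_sub hn).mpr ⟨n, by ring⟩, by omega⟩
    · rintro n ⟨hn, h1⟩
      obtain ⟨j, hj⟩ := (hw n).mp hn
      rcases eq_or_ne n m with rfl | hnm
      · exact Or.inr hs
      · exact Or.inl ⟨(hw _).mpr ⟨j - 1, by omega⟩, by omega⟩

/-! ### Deduction of the two assertions -/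

theorem exists_weight_of_not_isIrreducible {χ₁ χ₂ : RChar} {s₁ s₂ : ℂ} (h₁ : HasExponent χ₁ s₁)
    (h₂ : HasExponent χ₂ s₂) (h : ¬IsIrreducible χ₁ χ₂) :
    ∃ n : ℤ, IsWeight χ₁ χ₂ n ∧ s₁ - s₂ + 1 + n = 0 := by
  by_contra! hn
  exact h (isIrreducible_of_forall h₁ h₂ fun n hw h0 => absurd h0 (hn n hw))

/-- The exponents of two characters whose quotient is `t ↦ t ^ p` differ by `p`. -/
theorem HasExponent.sub_eq {χ₁ χ₂ : RChar} {s₁ s₂ : ℂ} (h₁ : HasExponent χ₁ s₁)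
    (h₂ : HasExponent χ₂ s₂) {p : ℤ}
    (h : ∀ t : ℝˣ, 0 < (t : ℝ) → (χ₁ t : ℂ) / (χ₂ t : ℂ) = ((t : ℝ) : ℂ) ^ p) : s₁ - s₂ = p := by
  have hexp : ∀ x : ℝ, Complex.exp ((s₁ - s₂ - p) * x) = 1 := by
    intro x
    have h3 := h (Units.mk0 (Real.exp x) (Real.exp_ne_zero x)) (Real.exp_pos x)
    rw [h₁ _ (Real.exp_pos x), h₂ _ (Real.exp_pos x), Units.val_mk0, Real.log_exp,
      ← Complex.exp_sub, Complex.ofReal_exp, ← Complex.exp_int_mul] at h3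
    rw [show (s₁ - s₂ - p) * (x : ℂ) = (s₁ * x - s₂ * x) - p * x by ring, Complex.exp_sub, h3,
      div_self (Complex.exp_ne_zero _)]
  have hd : HasDerivAt (fun x : ℝ => Complex.exp ((s₁ - s₂ - p) * x)) (s₁ - s₂ - p) 0 := by
    have := ((hasDerivAt_id ((0 : ℝ) : ℂ)).const_mul (s₁ - s₂ - p)).cexp.comp_ofReal
    simpa using this
  have h0 : (fun x : ℝ => Complex.exp ((s₁ - s₂ - p) * x)) = fun _ => 1 := funext hexp
  rw [h0] at hd
  exact sub_eq_zero.mp (hd.unique (hasDerivAt_const (0 : ℝ) (1 : ℂ)))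

/-- As `omega (-1) = -1`, the twist exchanges even and odd weights. -/
theorem isWeight_mul_omega_iff {χ₁ χ₂ : RChar} {n : ℤ} :
    IsWeight χ₁ (χ₂ * omega) n ↔ IsWeight χ₁ χ₂ (n + 1) := by
  have h : ((χ₂ * omega) (-1) : ℂ) = -χ₂ (-1) := by
    have h1 : (χ₂ * omega) (-1) = χ₂ (-1) * omega (-1) := rfl
    rw [h1, Units.val_mul, omega_neg_one, mul_neg_one]
  rw [IsWeight, IsWeight, h, zpow_add_one₀ (by norm_num), mul_neg, mul_neg_one, neg_eq_iff_eq_neg]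

theorem isReducible_xor_mul_omega {χ₁ χ₂ : RChar} {p : ℤ} (hp : p ≠ 0)
    (h : ∀ t : ℝˣ, 0 < (t : ℝ) → (χ₁ t : ℂ) / (χ₂ t : ℂ) = ((t : ℝ) : ℂ) ^ p) :
    (IsReducible χ₁ χ₂ ∧ IsIrreducible χ₁ (χ₂ * omega)) ∨
      (IsIrreducible χ₁ χ₂ ∧ IsReducible χ₁ (χ₂ * omega)) := by
  obtain ⟨s₁, h₁⟩ := exists_hasExponent χ₁
  obtain ⟨s₂, h₂⟩ := exists_hasExponent χ₂
  have hs := h₁.sub_eq h₂ h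
  have hzero : ∀ n : ℤ, s₁ - s₂ + 1 + n = 0 ↔ n = -p - 1 := by
    intro n
    rw [hs]
    constructor <;> intro h0
    · have : p + 1 + n = 0 := by exact_mod_cast h0
      omega
    · rw [h0]
      push_cast
      ring
  obtain ⟨m, hm⟩ := exists_isWeight χ₁ χ₂
  -- The parity of the critical integer `-p - 1` decides of which of the two representations it is a
  -- weight; `p ≠ 0` keeps it away from `-1`.
  rcases Int.even_or_odd (m - (-p - 1)) with he | ho
  · refine Or.inl ⟨isReducible_of_weight h₁ h₂ ((isWeight_iff_even_sub hm).mpr he)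
      ((hzero _).mpr rfl) (by omega), isIrreducible_of_forall h₁ h₂.mul_omega fun n hn h0 => ?_⟩
    rw [(hzero n).mp h0, isWeight_mul_omega_iff, isWeight_iff_even_sub hm] at hn
    obtain ⟨i, hi⟩ := he
    obtain ⟨j, hj⟩ := hn
    omega
  · refine Or.inr ⟨isIrreducible_of_forall h₁ h₂ fun n hn h0 => ?_,
      isReducible_of_weight h₁ h₂.mul_omega (isWeight_mul_omega_iff.mpr
        ((isWeight_iff_even_sub hm).mpr ?_)) ((hzero _).mpr rfl) (by omega)⟩
    · rw [(hzero n).mp h0, isWeight_iff_even_sub hm] at hn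
      exact absurd hn (Int.not_even_iff_odd.mpr ho)
    · obtain ⟨i, hi⟩ := ho
      exact ⟨i, by omega⟩

theorem isIrreducible_or_of_three (χ₁ χ₂ χ₃ : RChar) :
    IsIrreducible χ₁ χ₂ ∨ IsIrreducible χ₁ χ₃ ∨ IsIrreducible χ₂ χ₃ := by
  obtain ⟨s₁, h₁⟩ := exists_hasExponent χ₁
  obtain ⟨s₂, h₂⟩ := exists_hasExponent χ₂
  obtain ⟨s₃, h₃⟩ := exists_hasExponent χ₃
  by_contra! hcon
  obtain ⟨a, ha, ha0⟩ := exists_weight_of_not_isIrreducible h₁ h₂ hcon.1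
  obtain ⟨b, hb, hb0⟩ := exists_weight_of_not_isIrreducible h₁ h₃ hcon.2.1
  obtain ⟨c, hc, hc0⟩ := exists_weight_of_not_isIrreducible h₂ h₃ hcon.2.2
  -- The exponent differences add up, `(s₁ - s₂) + (s₂ - s₃) = s₁ - s₃`, but each critical weight
  -- carries its own shift by one.
  have hsum : b = a + c + 1 := by
    have : (b : ℂ) = a + c + 1 := by linear_combination hb0 - ha0 - hc0
    exact_mod_cast this
  -- In the product of the signs of the pairs `(1,2)` and `(2,3)` the factor `χ₂(-1) ^ 2 = 1` drops
  -- out, so `a + c` has the same parity as `b`.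
  have hw : IsWeight χ₁ χ₃ (a + c) := by
    rw [IsWeight] at ha hc ⊢
    rw [zpow_add₀ (by norm_num), ← ha, ← hc]
    linear_combination (-(χ₁ (-1) : ℂ) * χ₃ (-1)) * χ₂.sq_neg_one
  obtain ⟨j, hj⟩ := (isWeight_iff_even_sub hb).mp hw
  omega

end GL2R

theorem corollary1 :
    (∀ (χ₁ χ₂ : GL2R.RChar) (p : ℤ), p ≠ 0 →
      (∀ t : ℝˣ, 0 < (t : ℝ) → (χ₁ t : ℂ) / (χ₂ t : ℂ) = ((t : ℝ) : ℂ) ^ p) →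
      (GL2R.IsReducible χ₁ χ₂ ∧ GL2R.IsIrreducible χ₁ (χ₂ * GL2R.omega)) ∨
        (GL2R.IsIrreducible χ₁ χ₂ ∧ GL2R.IsReducible χ₁ (χ₂ * GL2R.omega))) ∧
    (∀ χ₁ χ₂ χ₃ : GL2R.RChar,
      GL2R.IsIrreducible χ₁ χ₂ ∨ GL2R.IsIrreducible χ₁ χ₃ ∨ GL2R.IsIrreducible χ₂ χ₃) :=
  ⟨fun _ _ _ hp h => GL2R.isReducible_xor_mul_omega hp h, GL2R.isIrreducible_or_of_three⟩
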